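/- Let $n\ge 1$ be an integer, let $0\le\delta<1$ and let $s\in\mathbb R$. For $f\in L^2(\mathbb R^n)$ and $t\in\mathbb R$ let $e^{it\sqrt{-\Delta}}f\in L^2(\mathbb R^n)$ be the function whose Fourier transform is $e^{it|\xi|}\hat f(\xi)$ (where $\hat f(\xi)=\int_{\mathbb R^n} e^{-ix\cdot\xi}f(x)\,dx$, extended to $L^2(\mathbb R^n)$), and let $H^s(\mathbb R^n)$ be the inhomogeneous Sobolev space, whose norm is $\|(1+|\xi|^2)^{s/2}\hat f\|_{L^2(\mathbb R^n)}$. Then $$e^{it\sqrt{-\Delta}}f(x)-f(x)=o(|t|^\delta)\quad\text{as } t\to 0,\ \text{ for almost every } x\in\mathbb R^n,$$ holds for every $f\in H^s(\mathbb R^n)\cap L^2(\mathbb R^n)$ (that is, every $f\in H^s(\mathbb R^n)$ when $s\ge 0$) if and only if $s>\frac12$ and $s\ge\delta$. Here, as $e^{it\sqrt{-\Delta}}f$ is for each $t$ a function determined up to null sets only, the displayed property of $f$ means: there is a measurable function $u:\mathbb R^n\times\mathbb R\to\mathbb C$ such that for every $t\in\mathbb R$ one has $u(x,t)=e^{it\sqrt{-\Delta}}f(x)$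 for almost every $x$, and such that for almost every $x\in\mathbb R^n$, $u(x,t)-f(x)=o(|t|^\delta)$ as $t\to0$, $t\neq 0$. -/

import Mathlib

open MeasureTheory Filter Topology Asymptotics FourierTransform

namespace HalfWave

/-- The Euclidean space `ℝⁿ`. -/
abbrev Space (n : ℕ) : Type := EuclideanSpace ℝ (Fin n)

/-- The complex Hilbert space `L²(ℝⁿ)` (Lebesgue measure). -/
abbrev L2 (n : ℕ) : Type := Lp (α := Space n) ℂ 2 (volume : Measure (Space n))

/-- The symbol of `e^{it√(-Δ)}`. Mathlib's Fourier transform is `∫ e^{-2πi⟨x,ξ⟩} f(x) dx`, for which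
`√(-Δ)` is multiplication by `2π|ξ|`. -/
noncomputable def symbol {n : ℕ} (t : ℝ) (ξ : Space n) : ℂ :=
  Complex.exp (((2 * Real.pi * ‖ξ‖ * t : ℝ) : ℂ) * Complex.I)

theorem continuous_symbol {n : ℕ} (t : ℝ) : Continuous (symbol (n := n) t) := by
  unfold symbol
  fun_prop

theorem norm_symbol {n : ℕ} (t : ℝ) (ξ : Space n) : ‖symbol t ξ‖ = 1 :=
  Complex.norm_exp_ofReal_mul_I _

theorem memLp_symbol_mul {n : ℕ} (t : ℝ) (g : L2 n) :
    MemLp (fun ξ => symbol t ξ * g ξ) 2 (volume : Measure (Space n)) :=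
  (Lp.memLp g).of_le
    ((continuous_symbol t).aestronglyMeasurable.mul (Lp.aestronglyMeasurable g))
    (Eventually.of_forall fun ξ => by rw [norm_mul, norm_symbol, one_mul])

/-- The operator `e^{it√(-Δ)}` on `L²(ℝⁿ)`: the Fourier multiplier with symbol `e^{it|ξ|}`
(in the normalization of `symbol`), through the Fourier transform of `L²(ℝⁿ)`. -/
noncomputable def propagator {n : ℕ} (t : ℝ) (f : L2 n) : L2 n :=
  𝓕⁻ ((memLp_symbol_mul t (𝓕 f)).toLp _)

/-- `f ∈ L²(ℝⁿ)` belongs to the inhomogeneous Sobolev space `H^s(ℝⁿ)`. For `s ≥ 0` these `f` are all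
of `H^s(ℝⁿ)`; for `s < 0` they are its elements in `L²(ℝⁿ)`. -/
def MemH {n : ℕ} (s : ℝ) (f : L2 n) : Prop :=
  TemperedDistribution.MemSobolev s 2 (f : TemperedDistribution (Space n) ℂ)

/-- `u` is a jointly measurable function on `ℝⁿ × ℝ` such that `u(·, t)` represents the `L²` class
`e^{it√(-Δ)} f` for every time `t`. -/
structure IsVersion {n : ℕ} (f : L2 n) (u : Space n → ℝ → ℂ) : Prop where
  measurable : Measurable (Function.uncurry u)
  ae_eq : ∀ t : ℝ, (fun x => u x t) =ᵐ[volume] propagator t f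

/-- `e^{it√(-Δ)} f(x) - f(x) = o(|t|^δ)` as `t → 0`, for almost every `x ∈ ℝⁿ`. Since
`e^{it√(-Δ)} f` is for each of the uncountably many `t` only a class of functions modulo null sets,
the pointwise statement is read for a jointly measurable version of it. -/
def ConvergesWithRate {n : ℕ} (δ : ℝ) (f : L2 n) : Prop :=
  ∃ u : Space n → ℝ → ℂ, IsVersion f u ∧
    ∀ᵐ x : Space n, (fun t : ℝ => u x t - f x) =o[𝓝[≠] 0] (fun t : ℝ => |t| ^ δ)

end HalfWave

/-!
Pointwise convergence rates for the half-wave evolution.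

*Sufficiency.* Since `H^s` decreases and the rate weakens, it suffices to treat `δ = s ∈ (1/2, 1)`.
By Plancherel's theorem the mean square increments of `t ↦ e^{it√(-Δ)} f` on the scale `2⁻ᵐ` are at
most `W m = ∫ min(2, 2π|ξ|2⁻ᵐ)² |f̂(ξ)|² dξ`, and `∑ₘ 4^{sm} W m ≲ ‖f‖²_{H^s}` because `0 < s < 1`
(`exists_tsum_pow_mul_min_le`). A Kolmogorov-type chaining argument (`exists_version_isLittleO`) turns
this into the pointwise statement: the interval `[-2⁻ʲ, 2⁻ʲ]` contains about `2^{m-j}` dyadic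
increments of scale `2⁻ᵐ`, and as `s > 1/2` the weight `4^{sm}` pays for their number. The supremum
over the interval, squared and multiplied by `4^{sj}`, is dominated by a sequence that is summable in
`j` for almost every `x`, hence tends to zero. The version is the limit along the dyadic
approximations of `t` from below.

*Necessity.* Fix a unit vector `e`. For `f` with frequencies in the union of the balls of radius
`1/2` about `e, 2e, 3e, …` the symbols `|ξ|` and `⟨ξ, e⟩` differ by `O(1/|ξ|)`, so that
`e^{it√(-Δ)} f` is the translation `f(· + te)` up to `O(t)` (`ae_norm_propagator_sub_le`), and a rate
for the evolution becomes a bound for the oscillation of `f` along lines. If it holds for all of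
`H^s`, Baire's theorem gives a bound for the oscillation that is uniform over a ball
(`exists_uniform_slowSet`). It is violated by the functions with Fourier transform
`ε ∑_{j<J} (2j+1)⁻¹ 1_{B(R(2j+1)e, 1/2)}`, whose oscillation over a half period `1/(2R)` is of size
`ε ∑ (2j+1)⁻¹`: for `s < δ` take `J = 1` and `R → ∞`, and for `s = 1/2` fix `R` and let `J → ∞`, where
the `H^{1/2}` norm grows only like the square root of the harmonic sum.
-/

namespace HalfWave

variable {n : ℕ}

section

open scoped ENNReal SchwartzMap ContDiff

/-! ### The Fourier transform on `L²` -/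

theorem continuous_neg_innerₗ :
    Continuous fun p : Space n × Space n => (-(innerₗ (Space n))) p.1 p.2 := by
  simp only [LinearMap.neg_apply, innerₗ_apply_apply]
  fun_prop

theorem continuous_fourierInv {G : Space n → ℂ} (hG : Integrable G) : Continuous (𝓕⁻ G) :=
  VectorFourier.fourierIntegral_continuous Real.continuous_fourierChar continuous_neg_innerₗ hG

/-- On `L¹ ∩ L²` the inverse Fourier transform of `L²` is given by the integral. -/
theorem fourierInv_toLp_ae_eq {G : Space n → ℂ} (h1 : Integrable G)
    (h2 : MemLp G 2 (volume : Measure (Space n))) :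
    (𝓕⁻ (h2.toLp G : L2 n) : L2 n) =ᵐ[volume] 𝓕⁻ G := by
  refine ae_eq_of_integral_contDiff_smul_eq
    ((Lp.memLp _).locallyIntegrable (by norm_num)) (continuous_fourierInv h1).locallyIntegrable ?_
  intro g g_smooth g_cpt
  have hg₁ : HasCompactSupport (Complex.ofRealCLM ∘ g) := g_cpt.comp_left rfl
  have hg₂ : ContDiff ℝ ∞ (Complex.ofRealCLM ∘ g) := by fun_prop
  set ψ : 𝓢(Space n, ℂ) := hg₁.toSchwartzMap hg₂
  have hψ : ∀ x, ψ x = (g x : ℂ) := fun x => rfl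
  have key := congrArg (fun T : 𝓢'(Space n, ℂ) => T ψ)
    (Lp.fourierInv_toTemperedDistribution_eq (h2.toLp G : L2 n))
  simp only [TemperedDistribution.fourierInv_apply, Lp.toTemperedDistribution_apply] at key
  calc
    _ = ∫ x, ψ x • (𝓕⁻ (h2.toLp G : L2 n) : L2 n) x := by
        simp only [hψ, Complex.real_smul, smul_eq_mul]
    _ = ∫ x, (𝓕⁻ ψ) x • (h2.toLp G : L2 n) x := key.symm
    _ = ∫ x, (𝓕⁻ (ψ : Space n → ℂ)) x • G x := by
        refine integral_congr_ae ?_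
        filter_upwards [h2.coeFn_toLp] with x hx
        rw [hx, SchwartzMap.fourierInv_coe]
    _ = ∫ x, ψ x • (𝓕⁻ G) x := by
        have := VectorFourier.integral_fourierIntegral_smul_eq_flip
          (μ := (volume : Measure (Space n))) (ν := (volume : Measure (Space n)))
          (L := -(innerₗ (Space n))) (f := ψ) (g := G)
          Real.continuous_fourierChar
          continuous_neg_innerₗ ψ.integrable h1
        have hflip : (-(innerₗ (Space n))).flip = -(innerₗ (Space n)) := by
          ext x y
          simp [real_inner_comm]
        rw [hflip] at this
        exact this
    _ = _ := by
        simp only [hψ, Complex.real_smul, smul_eq_mul]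

/-- Multiplication by a bounded function, as an operator on `L²`. -/
noncomputable def mulL {m : Space n → ℂ} (hm : MemLp m ∞ (volume : Measure (Space n))) :
    L2 n →L[ℂ] L2 n :=
  (ContinuousLinearMap.lsmul ℂ ℂ).holderL volume ∞ 2 2 (hm.toLp m)

theorem mulL_ae_eq {m : Space n → ℂ} (hm : MemLp m ∞ (volume : Measure (Space n))) (g : L2 n) :
    mulL hm g =ᵐ[volume] fun ξ => m ξ * g ξ := by
  have h := (ContinuousLinearMap.lsmul ℂ ℂ (E := ℂ)).coeFn_holder (r := 2) (hm.toLp m) g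
  filter_upwards [h, hm.coeFn_toLp] with ξ h1 h2
  rw [show mulL hm g = (ContinuousLinearMap.lsmul ℂ ℂ).holder 2 (hm.toLp m) g from rfl, h1, h2]
  rfl

theorem memLp_top_of_norm_le_one {m : Space n → ℂ} (hm : Measurable m) (hb : ∀ ξ, ‖m ξ‖ ≤ 1) :
    MemLp m ∞ (volume : Measure (Space n)) :=
  memLp_top_of_bound hm.aestronglyMeasurable 1 (Eventually.of_forall hb)

theorem memLp_top_symbol (t : ℝ) :
    MemLp (symbol (n := n) t) ∞ (volume : Measure (Space n)) :=
  memLp_top_of_norm_le_one (continuous_symbol t).measurable fun ξ => (norm_symbol t ξ).le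

theorem propagator_eq (t : ℝ) (f : L2 n) :
    propagator t f = 𝓕⁻ (mulL (memLp_top_symbol t) (𝓕 f)) := by
  rw [propagator]
  congr 1
  refine Lp.ext ?_
  filter_upwards [(memLp_symbol_mul t (𝓕 f)).coeFn_toLp, mulL_ae_eq (memLp_top_symbol t) (𝓕 f)]
    with ξ h1 h2
  rw [h1, h2]

/-- The weight `(1 + |ξ|²)^{-s/2}` whose multiples by `L²` functions are the Fourier transforms of
`H^s` functions. -/
noncomputable def decay (s : ℝ) (ξ : Space n) : ℂ := (((1 + ‖ξ‖ ^ 2) ^ (-s / 2) : ℝ) : ℂ)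

theorem memLp_top_decay {s : ℝ} (hs : 0 ≤ s) :
    MemLp (decay (n := n) s) ∞ (volume : Measure (Space n)) := by
  have hc : Continuous (decay (n := n) s) := by
    unfold decay
    refine Complex.continuous_ofReal.comp (Continuous.rpow_const (by fun_prop) fun ξ => Or.inl ?_)
    positivity
  refine memLp_top_of_norm_le_one hc.measurable fun ξ => ?_
  rw [decay, Complex.norm_real, Real.norm_of_nonneg (by positivity)]
  exact Real.rpow_le_one_of_one_le_of_nonpos (by nlinarith [sq_nonneg ‖ξ‖]) (by linarith)

/-- For `s ≥ 0` a function lies in `H^s` exactly if its Fourier transform is `(1 + |ξ|²)^{-s/2}`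
times a function of `L²`. -/
theorem memH_iff {s : ℝ} (hs : 0 ≤ s) (f : L2 n) :
    MemH s f ↔ ∃ g : L2 n, 𝓕 f = mulL (memLp_top_decay hs) g := by
  have hw : (decay (n := n) s).HasTemperateGrowth := by unfold decay; fun_prop
  have hw' : (fun ξ : Space n => (((1 + ‖ξ‖ ^ 2) ^ (s / 2) : ℝ) : ℂ)).HasTemperateGrowth := by
    fun_prop
  have hmul : ∀ g : L2 n, ((mulL (memLp_top_decay hs) g : L2 n) : 𝓢'(Space n, ℂ)) =
      TemperedDistribution.smulLeftCLM ℂ (decay s) (g : 𝓢'(Space n, ℂ)) := by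
    intro g
    rw [← Lp.toTemperedDistribution_smul_eq (p := ∞) (r := 2) hw (memLp_top_decay hs)]
    rfl
  have hone : (decay (n := n) s) * (fun ξ : Space n => (((1 + ‖ξ‖ ^ 2) ^ (s / 2) : ℝ) : ℂ))
      = fun _ => 1 := by
    funext ξ
    rw [Pi.mul_apply, decay]
    norm_cast
    rw [← Real.rpow_add (by positivity)]
    ring_nf
    simp
  have hinj : ∀ g h : L2 n, (g : 𝓢'(Space n, ℂ)) = h → g = h := fun g h hgh =>
    LinearMap.ker_eq_bot.1
      (Lp.ker_toTemperedDistributionCLM_eq_bot (F := ℂ) (μ := (volume : Measure (Space n)))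
        (p := 2)) hgh
  rw [MemH, TemperedDistribution.memSobolev_iff_exists_smulLeftCLM_fourier,
    Lp.fourier_toTemperedDistribution_eq]
  refine exists_congr fun g => ⟨fun h => hinj _ _ ?_, fun h => ?_⟩
  · rw [hmul, ← h, TemperedDistribution.smulLeftCLM_smulLeftCLM_apply hw' hw, mul_comm, hone]
    simp
  · rw [h, hmul, TemperedDistribution.smulLeftCLM_smulLeftCLM_apply hw hw', hone]
    simp

theorem MemH.mono {s s' : ℝ} (h : s' ≤ s) {f : L2 n} (hf : MemH s f) : MemH s' f :=
  TemperedDistribution.MemSobolev.mono h hf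

theorem ConvergesWithRate.mono {δ δ' : ℝ} (h : δ' ≤ δ) {f : L2 n} (hf : ConvergesWithRate δ f) :
    ConvergesWithRate δ' f := by
  obtain ⟨u, hu, hr⟩ := hf
  refine ⟨u, hu, ?_⟩
  filter_upwards [hr] with x hx
  refine hx.trans_isBigO (IsBigO.of_bound 1 ?_)
  have h1 : ∀ᶠ t : ℝ in 𝓝[≠] 0, |t| < 1 :=
    nhdsWithin_le_nhds ((continuous_abs.tendsto' 0 0 abs_zero).eventually (gt_mem_nhds one_pos))
  filter_upwards [h1, self_mem_nhdsWithin] with t ht ht0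
  rw [one_mul, Real.norm_of_nonneg (by positivity), Real.norm_of_nonneg (by positivity)]
  exact Real.rpow_le_rpow_of_exponent_ge (abs_pos.2 ht0) ht.le h

end

open scoped ENNReal

/-! ### Dyadic increments and a version of a process -/

/-- The largest multiple of `2⁻ᵐ` that is at most `t`. -/
noncomputable def dyadicFloor (m : ℕ) (t : ℝ) : ℝ := (⌊2 ^ m * t⌋ : ℝ) / 2 ^ m

theorem abs_dyadicFloor_sub_le (m : ℕ) (t : ℝ) : |dyadicFloor m t - t| ≤ 1 / 2 ^ m := by
  have h2 : (0 : ℝ) < 2 ^ m := by positivity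
  have h : dyadicFloor m t - t = (⌊2 ^ m * t⌋ - 2 ^ m * t) / 2 ^ m := by
    rw [dyadicFloor]; field_simp
  rw [h, abs_div, abs_of_pos h2]
  gcongr
  rw [abs_le]
  constructor <;> linarith [Int.floor_le (2 ^ m * t), Int.lt_floor_add_one (2 ^ m * t)]

/-- A sequence whose squares have a finite sum of integrals tends to zero almost everywhere. -/
theorem ae_tendsto_zero_of_tsum_lintegral {X : Type*} [MeasurableSpace X] {μ : Measure X}
    {F : ℕ → X → ℝ≥0∞} (hF : ∀ m, Measurable (F m)) (h : ∑' m, ∫⁻ x, F m x ∂μ ≠ ∞) :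
    ∀ᵐ x ∂μ, Tendsto (fun m => F m x) atTop (𝓝 0) := by
  rw [← lintegral_tsum fun m => (hF m).aemeasurable] at h
  filter_upwards [ae_lt_top (Measurable.tsum fun m => hF m) h] with x hx
  exact ENNReal.tendsto_atTop_zero_of_tsum_ne_top hx.ne

/-- The weighted square function of the increments of `g` over the dyadic points of the interval
`[-2⁻ʲ, 2⁻ʲ]`. -/
noncomputable def incrementSum {X : Type*} (g : ℝ → X → ℂ) (κ : ℝ≥0∞) (j : ℕ) (x : X) : ℝ≥0∞ :=
  ∑' l : ℕ, κ ^ l * ∑ i ∈ Finset.Ico (-2 ^ l : ℤ) (2 ^ l),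
    ‖g ((i + 1) / 2 ^ (j + l)) x - g (i / 2 ^ (j + l)) x‖ₑ ^ 2

theorem measurable_incrementSum {X : Type*} [MeasurableSpace X] {g : ℝ → X → ℂ}
    (hg : ∀ t, Measurable (g t)) (κ : ℝ≥0∞) (j : ℕ) : Measurable (incrementSum g κ j) := by
  unfold incrementSum
  refine Measurable.tsum fun l => ?_
  refine Measurable.const_mul (Finset.measurable_sum _ fun i _ => ?_) _
  exact (((hg _).sub (hg _)).enorm).pow_const 2

/-- There are `2 · 2ˡ` increments of scale `2⁻⁽ʲ⁺ˡ⁾` in `incrementSum g κ j`, so that on summation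
over `j` against `aʲ` the level `l` contributes a multiple of `(2κ/a)ˡ`. -/
theorem tsum_lintegral_incrementSum_le {X : Type*} [MeasurableSpace X] {μ : Measure X}
    {g : ℝ → X → ℂ} (hg : ∀ t, Measurable (g t)) {W : ℕ → ℝ≥0∞}
    (hW : ∀ m t t', |t - t'| ≤ 1 / 2 ^ m → ∫⁻ x, ‖g t x - g t' x‖ₑ ^ 2 ∂μ ≤ W m)
    {a κ q : ℝ≥0∞} (hq : 2 * κ = a * q) :
    ∑' j, ∫⁻ x, a ^ j * incrementSum g κ j x ∂μ
      ≤ 2 * (∑' l, q ^ l) * ∑' m, a ^ m * W m := by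
  have hterm : ∀ j : ℕ, ∫⁻ x, a ^ j * incrementSum g κ j x ∂μ
      ≤ ∑' l, 2 * q ^ l * (a ^ (j + l) * W (j + l)) := by
    intro j
    rw [lintegral_const_mul _ (measurable_incrementSum hg κ j)]
    unfold incrementSum
    rw [lintegral_tsum, ← ENNReal.tsum_mul_left]
    · refine ENNReal.tsum_le_tsum fun l => ?_
      rw [lintegral_const_mul, lintegral_finsetSum]
      · have hb : ∑ i ∈ Finset.Ico (-2 ^ l : ℤ) (2 ^ l),
            ∫⁻ x, ‖g ((i + 1) / 2 ^ (j + l)) x - g (i / 2 ^ (j + l)) x‖ₑ ^ 2 ∂μ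
            ≤ (2 * 2 ^ l : ℝ≥0∞) * W (j + l) := by
          refine (Finset.sum_le_card_nsmul _ _ (W (j + l)) fun i _ => hW _ _ _ ?_).trans ?_
          · rw [← sub_div, add_sub_cancel_left, abs_of_pos (by positivity)]
          · rw [nsmul_eq_mul, Int.card_Ico]
            gcongr
            have : ((2 : ℤ) ^ l - -2 ^ l).toNat = 2 * 2 ^ l := by
              rw [sub_neg_eq_add, ← two_mul]
              norm_cast
            rw [this]
            push_cast
            exact le_rfl
        calc a ^ j * (κ ^ l * _) ≤ a ^ j * (κ ^ l * ((2 * 2 ^ l) * W (j + l))) := by gcongr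
          _ = 2 * (a ^ j * (2 * κ) ^ l) * W (j + l) := by rw [mul_pow]; ring
          _ = 2 * q ^ l * (a ^ (j + l) * W (j + l)) := by rw [hq, mul_pow, pow_add]; ring
      · exact fun i _ => (((hg _).sub (hg _)).enorm).pow_const 2
      · exact Finset.measurable_sum _ fun i _ => (((hg _).sub (hg _)).enorm).pow_const 2
    · intro l
      exact (Measurable.const_mul (Finset.measurable_sum _ fun i _ =>
        (((hg _).sub (hg _)).enorm).pow_const 2) _).aemeasurable
  calc ∑' j, ∫⁻ x, a ^ j * incrementSum g κ j x ∂μ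
      ≤ ∑' j, ∑' l, 2 * q ^ l * (a ^ (j + l) * W (j + l)) := ENNReal.tsum_le_tsum hterm
    _ = ∑' l, ∑' j, 2 * q ^ l * (a ^ (j + l) * W (j + l)) := ENNReal.tsum_comm
    _ ≤ ∑' l, 2 * q ^ l * ∑' m, a ^ m * W m := by
        refine ENNReal.tsum_le_tsum fun l => ?_
        rw [ENNReal.tsum_mul_left]
        refine mul_le_mul_right ?_ _
        exact ENNReal.tsum_comp_le_tsum_of_injective (add_left_injective l) fun m => a ^ m * W m
    _ = 2 * (∑' l, q ^ l) * ∑' m, a ^ m * W m := by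
        rw [ENNReal.tsum_mul_right, ENNReal.tsum_mul_left]

/-- If the increments of `g` over the dyadic points near `0` are controlled by `b`, then the limit
of `g` along the dyadic approximations of `t` exists and is within `O(b)` of `g 0`. -/
theorem exists_tendsto_dyadicFloor {X : Type*} {g : ℝ → X → ℂ} {x : X} {j : ℕ} {r b : ℝ}
    (hr0 : 0 < r) (hr1 : r < 1) (hb : 0 ≤ b)
    (h : incrementSum g (ENNReal.ofReal (r⁻¹ ^ 2)) j x ≤ ENNReal.ofReal (b ^ 2))
    {t : ℝ} (ht1 : -(1 / 2 ^ j) ≤ t) (ht2 : t < 1 / 2 ^ j) :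
    ∃ y, Tendsto (fun m => g (dyadicFloor m t) x) atTop (𝓝 y) ∧
      ‖y - g 0 x‖ ≤ b * (1 + 1 / (1 - r)) := by
  have hinc : ∀ (l : ℕ) (i : ℤ), -2 ^ l ≤ i → i < 2 ^ l →
      ‖g ((i + 1) / 2 ^ (j + l)) x - g (i / 2 ^ (j + l)) x‖ ≤ b * r ^ l := by
    intro l i hi1 hi2
    have h1 : ENNReal.ofReal (r⁻¹ ^ 2) ^ l *
        ‖g ((i + 1) / 2 ^ (j + l)) x - g (i / 2 ^ (j + l)) x‖ₑ ^ 2 ≤ ENNReal.ofReal (b ^ 2) := by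
      refine le_trans ?_ h
      refine le_trans ?_ (ENNReal.le_tsum l)
      gcongr
      exact Finset.single_le_sum
        (f := fun i : ℤ => ‖g ((i + 1) / 2 ^ (j + l)) x - g (i / 2 ^ (j + l)) x‖ₑ ^ 2)
        (fun _ _ => zero_le) (Finset.mem_Ico.2 ⟨hi1, hi2⟩)
    rw [← ofReal_norm, ← ENNReal.ofReal_pow (by positivity), ← ENNReal.ofReal_pow (by positivity),
      ← ENNReal.ofReal_mul (by positivity), ENNReal.ofReal_le_ofReal_iff (by positivity)] at h1
    have h2 : (‖g ((i + 1) / 2 ^ (j + l)) x - g (i / 2 ^ (j + l)) x‖ * (r⁻¹) ^ l) ^ 2 ≤ b ^ 2 := by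
      calc _ = (r⁻¹ ^ 2) ^ l * ‖g ((i + 1) / 2 ^ (j + l)) x - g (i / 2 ^ (j + l)) x‖ ^ 2 := by
            rw [mul_pow, ← pow_mul, ← pow_mul, mul_comm l 2]; ring
        _ ≤ b ^ 2 := h1
    have h3 := le_of_sq_le_sq h2 hb
    rwa [inv_pow, ← div_eq_mul_inv, div_le_iff₀ (by positivity)] at h3
  -- the integer part of `2^(j+l) t` is an index of the increments on scale `l`
  have hk : ∀ l : ℕ, -2 ^ l ≤ ⌊2 ^ (j + l) * t⌋ ∧ ⌊2 ^ (j + l) * t⌋ < 2 ^ l := by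
    intro l
    have e : (2 : ℝ) ^ (j + l) * (1 / 2 ^ j) = 2 ^ l := by rw [pow_add]; field_simp
    have hp : (0 : ℝ) < 2 ^ (j + l) := by positivity
    constructor
    · rw [Int.le_floor]
      push_cast
      rw [← e]
      nlinarith
    · rw [Int.floor_lt]
      push_cast
      rw [← e]
      nlinarith
  set y : ℕ → ℂ := fun l => g (dyadicFloor (j + l) t) x with hy
  have hdist : ∀ l, dist (y l) (y (l + 1)) ≤ b * r ^ l := by
    intro l
    set k := ⌊2 ^ (j + l) * t⌋ with hkdef
    obtain ⟨hk1, hk2⟩ := hk l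
    have hlow : (k : ℝ) ≤ 2 ^ (j + l) * t := Int.floor_le _
    have hupp : 2 ^ (j + l) * t < k + 1 := Int.lt_floor_add_one _
    have hbase : dyadicFloor (j + l) t = ((2 * k : ℤ) : ℝ) / 2 ^ (j + (l + 1)) := by
      rw [dyadicFloor, ← hkdef, ← add_assoc, pow_succ]
      push_cast
      field_simp
    have hcases : ⌊2 ^ (j + (l + 1)) * t⌋ = 2 * k ∨ ⌊2 ^ (j + (l + 1)) * t⌋ = 2 * k + 1 := by
      have e : (2 : ℝ) ^ (j + (l + 1)) * t = 2 * (2 ^ (j + l) * t) := by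
        rw [← add_assoc, pow_succ]; ring
      have h1 : 2 * k ≤ ⌊2 ^ (j + (l + 1)) * t⌋ := by
        rw [Int.le_floor, e]; push_cast; linarith
      have h2 : ⌊2 ^ (j + (l + 1)) * t⌋ < 2 * k + 2 := by
        rw [Int.floor_lt, e]; push_cast; linarith
      omega
    rcases hcases with hc | hc
    · have : dyadicFloor (j + (l + 1)) t = dyadicFloor (j + l) t := by
        rw [hbase, dyadicFloor, hc]
      simp only [hy, this, dist_self]
      positivity
    · have hnext : dyadicFloor (j + (l + 1)) t = (((2 * k : ℤ) : ℝ) + 1) / 2 ^ (j + (l + 1)) := by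
        rw [dyadicFloor, hc]; push_cast; rfl
      rw [dist_comm, dist_eq_norm]
      simp only [hy]
      rw [hnext, hbase]
      refine (hinc (l + 1) (2 * k) ?_ ?_).trans ?_
      · rw [pow_succ]; linarith
      · rw [pow_succ]; linarith
      · exact mul_le_mul_of_nonneg_left (pow_le_pow_of_le_one hr0.le hr1.le (Nat.le_succ l)) hb
  have hzero : ‖y 0 - g 0 x‖ ≤ b := by
    obtain ⟨hk1, hk2⟩ := hk 0
    simp only [hy, add_zero, pow_zero] at hk1 hk2 ⊢
    have : ⌊2 ^ j * t⌋ = 0 ∨ ⌊2 ^ j * t⌋ = -1 := by omega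
    rcases this with hc | hc
    · simp [dyadicFloor, hc, hb]
    · have := hinc 0 (-1) (by norm_num) (by norm_num)
      rw [norm_sub_rev] at this
      simpa [dyadicFloor, hc] using this
  obtain ⟨z, hz⟩ := cauchySeq_tendsto_of_complete (cauchySeq_of_le_geometric r b hr1 hdist)
  refine ⟨z, ?_, ?_⟩
  · rw [← tendsto_add_atTop_iff_nat j]
    simpa only [hy, add_comm] using hz
  · have h1 := dist_le_of_le_geometric_of_tendsto₀ r b hr1 hdist hz
    rw [dist_comm, dist_eq_norm] at h1
    calc ‖z - g 0 x‖ = ‖(z - y 0) + (y 0 - g 0 x)‖ := by rw [sub_add_sub_cancel]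
      _ ≤ b / (1 - r) + b := (norm_add_le _ _).trans (add_le_add h1 hzero)
      _ = b * (1 + 1 / (1 - r)) := by ring

/-- A Kolmogorov-type criterion at a single time: if the mean square increments of `g` at scale
`2⁻ᵐ` are summable against `4^{sm}` with `s > 1/2`, then `g` has a jointly measurable version
that at almost every point is `o(|t|^s)`-close to `g 0` as `t → 0`. -/
theorem exists_version_isLittleO {X : Type*} [MeasurableSpace X] {μ : Measure X}
    {g : ℝ → X → ℂ} (hg : ∀ t, Measurable (g t)) {W : ℕ → ℝ≥0∞}
    (hW : ∀ m t t', |t - t'| ≤ 1 / 2 ^ m → ∫⁻ x, ‖g t x - g t' x‖ₑ ^ 2 ∂μ ≤ W m)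
    {s : ℝ} (hs : 1 / 2 < s) (hsum : ∑' m, ENNReal.ofReal (4 ^ s) ^ m * W m ≠ ∞) :
    ∃ u : X → ℝ → ℂ, Measurable (Function.uncurry u) ∧ (∀ t, (fun x => u x t) =ᵐ[μ] g t) ∧
      ∀ᵐ x ∂μ, (fun t : ℝ => u x t - g 0 x) =o[𝓝[≠] 0] fun t : ℝ => |t| ^ s := by
  set a : ℝ := 4 ^ s with ha
  have ha2 : 2 < a := by
    calc (2 : ℝ) = 4 ^ (1 / 2 : ℝ) := by
          rw [← Real.sqrt_eq_rpow, show (4 : ℝ) = 2 ^ 2 by norm_num]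
          exact (Real.sqrt_sq (by norm_num)).symm
      _ < a := Real.rpow_lt_rpow_of_exponent_lt (by norm_num) hs
  refine ⟨fun x t => limUnder atTop fun m => g (dyadicFloor m t) x, ?_, ?_, ?_⟩
  · have hm : ∀ m : ℕ, Measurable fun p : X × ℝ => g (dyadicFloor m p.2) p.1 := by
      intro m
      have h1 : Measurable fun q : X × ℤ => g ((q.2 : ℝ) / 2 ^ m) q.1 :=
        measurable_from_prod_countable_left fun k => hg ((k : ℝ) / 2 ^ m)
      have h2 : Measurable fun p : X × ℝ => (p.1, ⌊2 ^ m * p.2⌋) := by fun_prop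
      exact h1.comp h2
    exact (StronglyMeasurable.limUnder fun m => (hm m).stronglyMeasurable).measurable
  · intro t
    have hfin : ∑' m, ∫⁻ x, ‖g (dyadicFloor m t) x - g t x‖ₑ ^ 2 ∂μ ≠ ∞ := by
      refine ne_top_of_le_ne_top hsum (ENNReal.tsum_le_tsum fun m => ?_)
      refine (hW m _ _ (abs_dyadicFloor_sub_le m t)).trans ?_
      refine le_mul_of_one_le_left zero_le (one_le_pow₀ ?_)
      rw [ENNReal.one_le_ofReal]
      linarith
    filter_upwards [ae_tendsto_zero_of_tsum_lintegral
      (fun m => (((hg _).sub (hg _)).enorm).pow_const 2) hfin] with x hx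
    refine Tendsto.limUnder_eq ?_
    rw [tendsto_iff_norm_sub_tendsto_zero]
    have h1 : Tendsto (fun m => ‖g (dyadicFloor m t) x - g t x‖ ^ 2) atTop (𝓝 0) := by
      have := (ENNReal.tendsto_toReal ENNReal.zero_ne_top).comp hx
      simpa [Function.comp_def] using this
    have h2 := h1.sqrt
    simpa [Real.sqrt_sq] using h2
  · -- a ratio `r < 1` with `2 r⁻² < a`
    obtain ⟨r, hr0, hr1, hra⟩ : ∃ r : ℝ, 0 < r ∧ r < 1 ∧ 2 * r⁻¹ ^ 2 < a := by
      refine ⟨√(2 * 2 / (a + 2)), by positivity, ?_, ?_⟩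
      · rw [Real.sqrt_lt' one_pos, div_lt_iff₀ (by linarith)]
        linarith
      · rw [inv_pow, Real.sq_sqrt (by positivity)]
        field_simp
        linarith
    have hfin : ∑' j, ∫⁻ x, ENNReal.ofReal a ^ j *
        incrementSum g (ENNReal.ofReal (r⁻¹ ^ 2)) j x ∂μ ≠ ∞ := by
      refine ne_top_of_le_ne_top ?_ (tsum_lintegral_incrementSum_le hg hW
        (q := ENNReal.ofReal (2 * r⁻¹ ^ 2 / a)) ?_)
      · refine ENNReal.mul_ne_top (ENNReal.mul_ne_top (by norm_num) ?_) hsum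
        rw [ENNReal.tsum_geometric, ENNReal.inv_ne_top]
        refine (tsub_pos_of_lt ?_).ne'
        rw [ENNReal.ofReal_lt_one, div_lt_one (by linarith)]
        exact hra
      · rw [← ENNReal.ofReal_mul (by positivity), mul_div_cancel₀ _ (by positivity),
          ENNReal.ofReal_mul (by norm_num)]
        simp
    filter_upwards [ae_tendsto_zero_of_tsum_lintegral
      (fun j => (measurable_incrementSum hg _ j).const_mul _) hfin] with x hx
    refine IsLittleO.of_bound fun c hc => ?_
    have hK : 0 < 1 + 1 / (1 - r) := by
      have : 0 < 1 - r := by linarith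
      positivity
    set b : ℝ := c / (4 ^ s * (1 + 1 / (1 - r))) with hbdef
    have hb : 0 < b := by positivity
    obtain ⟨J, hJ⟩ := eventually_atTop.1 (hx.eventually
      (ge_mem_nhds (show (0 : ℝ≥0∞) < ENNReal.ofReal (b ^ 2) by simp; positivity)))
    have hsmall : ∀ᶠ t : ℝ in 𝓝[≠] 0, |t| < (1 / 2) ^ (J + 1) :=
      nhdsWithin_le_nhds ((continuous_abs.tendsto' 0 0 abs_zero).eventually
        (gt_mem_nhds (by positivity)))
    filter_upwards [hsmall, self_mem_nhdsWithin] with t ht ht0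
    have htpos : 0 < |t| := abs_pos.2 ht0
    obtain ⟨j, hj1, hj2⟩ := exists_nat_pow_near_of_lt_one htpos
      (ht.le.trans (pow_le_one₀ (by norm_num) (by norm_num))) (by norm_num : (0 : ℝ) < 1 / 2)
      (by norm_num)
    have hjJ : J + 1 < j + 1 :=
      (pow_lt_pow_iff_right_of_lt_one₀ (by norm_num) (by norm_num)).1 (hj1.trans ht)
    obtain ⟨i, rfl⟩ : ∃ i, j = i + 1 := ⟨j - 1, by omega⟩
    have hi2 : (0 : ℝ) < 2 ^ i := by positivity
    have hti : |t| < 1 / 2 ^ i := by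
      refine hj2.trans_lt ?_
      rw [one_div_pow]
      gcongr <;> norm_num
    have hit : 1 / 2 ^ i ≤ 4 * |t| := by
      have : (1 / 2 : ℝ) ^ (i + 1 + 1) = 1 / 2 ^ i / 4 := by
        rw [one_div_pow, pow_succ, pow_succ]; field_simp; norm_num
      linarith
    have hai : a ^ i = (((2 : ℝ) ^ i) ^ s) ^ 2 := by
      rw [ha, ← Real.rpow_natCast, ← Real.rpow_natCast, ← Real.rpow_natCast,
        ← Real.rpow_mul (by norm_num), ← Real.rpow_mul (by norm_num), ← Real.rpow_mul (by norm_num),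
        show (4 : ℝ) = 2 ^ (2 : ℝ) by norm_num, ← Real.rpow_mul (by norm_num)]
      congr 1
      push_cast
      ring
    have hbound : incrementSum g (ENNReal.ofReal (r⁻¹ ^ 2)) i x
        ≤ ENNReal.ofReal ((b * (1 / 2 ^ i) ^ s) ^ 2) := by
      have h1 := hJ i (by omega)
      rw [← ENNReal.ofReal_pow (by positivity), mul_comm,
        ← ENNReal.le_div_iff_mul_le (Or.inl (by simp; positivity)) (Or.inl ENNReal.ofReal_ne_top),
        ← ENNReal.ofReal_div_of_pos (by positivity)] at h1
      refine h1.trans_eq ?_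
      rw [hai, Real.div_rpow (by norm_num) hi2.le, Real.one_rpow]
      congr 1
      ring
    obtain ⟨z, hz, hz'⟩ := exists_tendsto_dyadicFloor hr0 hr1 (by positivity) hbound
      (t := t) (by linarith [neg_abs_le t]) ((le_abs_self t).trans_lt hti)
    rw [hz.limUnder_eq, Real.norm_of_nonneg (by positivity : (0 : ℝ) ≤ |t| ^ s)]
    calc ‖z - g 0 x‖ ≤ b * (1 / 2 ^ i) ^ s * (1 + 1 / (1 - r)) := hz'
      _ ≤ b * (4 * |t|) ^ s * (1 + 1 / (1 - r)) := by gcongr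
      _ = c * |t| ^ s := by
        rw [Real.mul_rpow (by norm_num) htpos.le, hbdef]
        have : (0 : ℝ) < 4 ^ s := by positivity
        field_simp

/-! ### Mean square increments of the half-wave evolution -/

/-- For `0 < s < 1` the squared multipliers `min(2, ρ 2⁻ᵐ)²` sum against `4^{sm}` to a multiple of
`(1 + ρ²)^s`: the terms grow geometrically while `2ᵐ < ρ` and decay geometrically afterwards. -/
theorem exists_tsum_pow_mul_min_le {s : ℝ} (hs0 : 0 < s) (hs1 : s < 1) :
    ∃ C : ℝ, 0 ≤ C ∧ ∀ ρ : ℝ, 0 ≤ ρ →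
      ∑' m : ℕ, ENNReal.ofReal (4 ^ s) ^ m * ENNReal.ofReal (min 4 ((ρ / 2 ^ m) ^ 2))
        ≤ ENNReal.ofReal (C * (1 + ρ ^ 2) ^ s) := by
  set a : ℝ := 4 ^ s with ha
  have ha1 : 1 < a := Real.one_lt_rpow (by norm_num) hs0
  have ha4 : a < 4 := by
    calc a < 4 ^ (1 : ℝ) := Real.rpow_lt_rpow_of_exponent_lt (by norm_num) hs1
      _ = 4 := Real.rpow_one 4
  have ha0 : 0 < a := by linarith
  have h7 : 0 < a - 1 := by linarith
  have h8 : 0 < 1 - a / 4 := by linarith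
  refine ⟨(4 / (a - 1) + 1 / (1 - a / 4)) * 4 ^ s, by positivity, fun ρ hρ => ?_⟩
  -- the dyadic scale of `max 1 ρ`
  obtain ⟨M, hM1, hM2⟩ : ∃ M : ℕ, ρ ≤ 2 ^ M ∧ (4 : ℝ) ^ M ≤ 4 * (1 + ρ ^ 2) := by
    obtain ⟨m, h1, h2⟩ := exists_nat_pow_near (le_max_left 1 ρ) (one_lt_two : (1 : ℝ) < 2)
    refine ⟨m + 1, (le_max_right 1 ρ).trans h2.le, ?_⟩
    have : (4 : ℝ) ^ (m + 1) = 4 * (2 ^ m) ^ 2 := by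
      rw [show (4 : ℝ) = 2 ^ 2 by norm_num, ← pow_mul, ← pow_mul, ← pow_add]; congr 1; ring
    rw [this]
    gcongr
    refine (pow_le_pow_left₀ (by positivity) h1 2).trans ?_
    rcases max_choice 1 ρ with h | h <;> rw [h] <;> nlinarith [sq_nonneg ρ]
  have haM : a ^ M ≤ 4 ^ s * (1 + ρ ^ 2) ^ s := by
    calc a ^ M = ((4 : ℝ) ^ M) ^ s := by
          rw [ha, ← Real.rpow_natCast, ← Real.rpow_natCast, ← Real.rpow_mul (by norm_num),
            ← Real.rpow_mul (by norm_num), mul_comm]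
      _ ≤ (4 * (1 + ρ ^ 2)) ^ s := by gcongr
      _ = _ := Real.mul_rpow (by norm_num) (by positivity)
  have hlow : ∑ m ∈ Finset.range M, ENNReal.ofReal a ^ m *
      ENNReal.ofReal (min 4 ((ρ / 2 ^ m) ^ 2)) ≤ ENNReal.ofReal (4 / (a - 1) * a ^ M) := by
    calc _ ≤ ∑ m ∈ Finset.range M, ENNReal.ofReal (a ^ m * 4) := by
          refine Finset.sum_le_sum fun m _ => ?_
          rw [← ENNReal.ofReal_pow ha0.le, ← ENNReal.ofReal_mul (by positivity)]
          gcongr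
          exact min_le_left _ _
      _ = ENNReal.ofReal ((a ^ M - 1) / (a - 1) * 4) := by
          rw [← ENNReal.ofReal_sum_of_nonneg fun m _ => by positivity, ← Finset.sum_mul,
            geom_sum_eq ha1.ne']
      _ ≤ _ := by
          refine ENNReal.ofReal_le_ofReal ?_
          have : 0 < a - 1 := by linarith
          rw [div_mul_eq_mul_div, div_mul_eq_mul_div]
          refine (div_le_div_iff_of_pos_right this).2 ?_
          linarith
  have hhigh : ∑' k, ENNReal.ofReal a ^ (k + M) *
      ENNReal.ofReal (min 4 ((ρ / 2 ^ (k + M)) ^ 2))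
      ≤ ENNReal.ofReal (1 / (1 - a / 4) * a ^ M) := by
    have h4 : a / 4 < 1 := by linarith
    calc _ ≤ ∑' k, ENNReal.ofReal (a ^ M * (a / 4) ^ k) := by
          refine ENNReal.tsum_le_tsum fun k => ?_
          rw [← ENNReal.ofReal_pow ha0.le, ← ENNReal.ofReal_mul (by positivity)]
          refine ENNReal.ofReal_le_ofReal ?_
          have h5 : (ρ / 2 ^ (k + M)) ^ 2 ≤ (1 / 4) ^ k := by
            have h6 : ρ / 2 ^ (k + M) ≤ 1 / 2 ^ k := by
              rw [pow_add, div_le_div_iff₀ (by positivity) (by positivity)]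
              nlinarith [pow_pos (two_pos : (0 : ℝ) < 2) k]
            calc _ ≤ (1 / 2 ^ k : ℝ) ^ 2 := by gcongr
              _ = _ := by
                rw [one_div_pow, one_div_pow, ← pow_mul, mul_comm, pow_mul]; norm_num
          calc a ^ (k + M) * min 4 ((ρ / 2 ^ (k + M)) ^ 2) ≤ a ^ (k + M) * (1 / 4) ^ k := by
                gcongr
                exact (min_le_right _ _).trans h5
            _ = _ := by rw [pow_add, div_pow, div_pow, one_pow]; ring
      _ = ENNReal.ofReal (∑' k, a ^ M * (a / 4) ^ k) :=
          (ENNReal.ofReal_tsum_of_nonneg (fun k => by positivity)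
            ((summable_geometric_of_lt_one (by positivity) h4).mul_left _)).symm
      _ = _ := by
          rw [tsum_mul_left, tsum_geometric_of_lt_one (by positivity) h4, one_div, mul_comm]
  rw [← Summable.sum_add_tsum_nat_add' (k := M) ENNReal.summable]
  refine (add_le_add hlow hhigh).trans ?_
  rw [← ENNReal.ofReal_add (by positivity) (by positivity), ← add_mul, mul_assoc]
  gcongr

theorem lintegral_enorm_sq (h : L2 n) : ∫⁻ x, ‖h x‖ₑ ^ 2 = ‖h‖ₑ ^ 2 := by
  have := eLpNorm_nnreal_pow_eq_lintegral (f := h) (μ := (volume : Measure (Space n)))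
    (p := 2) (by norm_num)
  rw [Lp.enorm_def]
  simpa using! this.symm

theorem norm_exp_mul_I_sub_le (a b : ℝ) :
    ‖Complex.exp (a * Complex.I) - Complex.exp (b * Complex.I)‖ ≤ |a - b| := by
  have h : Complex.exp (a * Complex.I) - Complex.exp (b * Complex.I)
      = Complex.exp (b * Complex.I) * (Complex.exp (Complex.I * ((a - b : ℝ) : ℂ)) - 1) := by
    rw [mul_sub, ← Complex.exp_add, mul_one]
    congr 2
    push_cast
    ring
  rw [h, norm_mul, Complex.norm_exp_ofReal_mul_I, one_mul]
  exact Real.norm_exp_I_mul_ofReal_sub_one_le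

theorem norm_symbol_sub_symbol_le (t t' : ℝ) (ξ : Space n) :
    ‖symbol t ξ - symbol t' ξ‖ ≤ 2 * Real.pi * ‖ξ‖ * |t - t'| := by
  refine (norm_exp_mul_I_sub_le _ _).trans_eq ?_
  rw [← mul_sub, abs_mul, abs_of_nonneg (by positivity)]

theorem norm_fourierInv (g : L2 n) : ‖(𝓕⁻ g : L2 n)‖ = ‖g‖ :=
  (Lp.fourierTransformₗᵢ (Space n) ℂ).symm.norm_map g

theorem fourierInv_sub (g h : L2 n) : (𝓕⁻ (g - h) : L2 n) = 𝓕⁻ g - 𝓕⁻ h :=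
  (Lp.fourierTransformₗᵢ (Space n) ℂ).symm.map_sub g h

/-- Mean square increments of `e^{it√(-Δ)} f` on the scale `2⁻ᵐ`, by Plancherel's theorem. -/
theorem lintegral_propagator_sub_le (f : L2 n) (m : ℕ) (t t' : ℝ) (h : |t - t'| ≤ 1 / 2 ^ m) :
    ∫⁻ x, ‖propagator t f x - propagator t' f x‖ₑ ^ 2
      ≤ ∫⁻ ξ, ENNReal.ofReal (min 4 ((2 * Real.pi * ‖ξ‖ / 2 ^ m) ^ 2)) * ‖(𝓕 f : L2 n) ξ‖ₑ ^ 2 := by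
  have h1 : ∫⁻ x, ‖propagator t f x - propagator t' f x‖ₑ ^ 2
      = ∫⁻ x, ‖(propagator t f - propagator t' f : L2 n) x‖ₑ ^ 2 := by
    refine lintegral_congr_ae ?_
    filter_upwards [Lp.coeFn_sub (propagator t f) (propagator t' f)] with x hx
    rw [hx, Pi.sub_apply]
  have h2 : ‖(propagator t f - propagator t' f : L2 n)‖ₑ
      = ‖mulL (memLp_top_symbol t) (𝓕 f) - mulL (memLp_top_symbol t') (𝓕 f)‖ₑ := by
    rw [propagator_eq, propagator_eq, ← fourierInv_sub, ← ofReal_norm, ← ofReal_norm,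
      norm_fourierInv]
  rw [h1, lintegral_enorm_sq, h2, ← lintegral_enorm_sq]
  refine lintegral_mono_ae ?_
  filter_upwards [Lp.coeFn_sub (mulL (memLp_top_symbol t) (𝓕 f)) (mulL (memLp_top_symbol t') (𝓕 f)),
    mulL_ae_eq (memLp_top_symbol t) (𝓕 f), mulL_ae_eq (memLp_top_symbol t') (𝓕 f)] with ξ e1 e2 e3
  rw [e1, Pi.sub_apply, e2, e3, ← sub_mul, enorm_mul, mul_pow]
  gcongr
  rw [← ofReal_norm, ← ENNReal.ofReal_pow (norm_nonneg _)]
  refine ENNReal.ofReal_le_ofReal (le_min ?_ ?_)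
  · have : ‖symbol t ξ - symbol t' ξ‖ ≤ 2 := by
      refine (norm_sub_le _ _).trans ?_
      rw [norm_symbol, norm_symbol]
      norm_num
    nlinarith [norm_nonneg (symbol t ξ - symbol t' ξ)]
  · gcongr
    refine (norm_symbol_sub_symbol_le t t' ξ).trans ?_
    rw [div_eq_mul_one_div]
    gcongr

theorem propagator_zero (f : L2 n) : propagator 0 f = f := by
  have : mulL (memLp_top_symbol 0) (𝓕 f) = 𝓕 f := by
    refine Lp.ext ?_
    filter_upwards [mulL_ae_eq (memLp_top_symbol 0) (𝓕 f)] with ξ h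
    rw [h, symbol]
    simp
  rw [propagator_eq, this, fourierInv_fourier_eq]

/-- The pointwise convergence rate at the critical regularity, `δ = s ∈ (1/2, 1)`. -/
theorem convergesWithRate_of_memH {s : ℝ} (hs : 1 / 2 < s) (hs1 : s < 1) {f : L2 n}
    (hf : MemH s f) : ConvergesWithRate s f := by
  have hs0 : 0 < s := by linarith
  obtain ⟨g, hg⟩ := (memH_iff hs0.le f).1 hf
  obtain ⟨C, hC0, hC⟩ := exists_tsum_pow_mul_min_le hs0 hs1
  have hsum : ∑' m : ℕ, ENNReal.ofReal (4 ^ s) ^ m *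
      ∫⁻ ξ, ENNReal.ofReal (min 4 ((2 * Real.pi * ‖ξ‖ / 2 ^ m) ^ 2)) * ‖(𝓕 f : L2 n) ξ‖ₑ ^ 2
        ≠ ∞ := by
    have hmeas : ∀ m : ℕ, AEMeasurable (fun ξ : Space n =>
        ENNReal.ofReal (min 4 ((2 * Real.pi * ‖ξ‖ / 2 ^ m) ^ 2)) * ‖(𝓕 f : L2 n) ξ‖ₑ ^ 2) := by
      intro m
      have h1 : Measurable fun ξ : Space n =>
          ENNReal.ofReal (min 4 ((2 * Real.pi * ‖ξ‖ / 2 ^ m) ^ 2)) := by fun_prop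
      refine AEMeasurable.mul h1.aemeasurable ?_
      exact ((Lp.stronglyMeasurable (𝓕 f : L2 n)).measurable.enorm.pow_const 2).aemeasurable
    have hle : ∀ᵐ ξ : Space n, ∑' m : ℕ, ENNReal.ofReal (4 ^ s) ^ m *
        (ENNReal.ofReal (min 4 ((2 * Real.pi * ‖ξ‖ / 2 ^ m) ^ 2)) * ‖(𝓕 f : L2 n) ξ‖ₑ ^ 2)
        ≤ ENNReal.ofReal (C * ((2 * Real.pi) ^ 2) ^ s) * ‖g ξ‖ₑ ^ 2 := by
      filter_upwards [mulL_ae_eq (memLp_top_decay hs0.le) g] with ξ hξ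
      simp_rw [← mul_assoc]
      rw [ENNReal.tsum_mul_right, hg, hξ, enorm_mul, mul_pow, ← mul_assoc]
      gcongr
      refine (mul_le_mul_left (hC _ (by positivity)) _).trans ?_
      have hd : ‖decay s ξ‖ ^ 2 = ((1 + ‖ξ‖ ^ 2) ^ s)⁻¹ := by
        rw [decay, Complex.norm_real, Real.norm_of_nonneg (by positivity), ← Real.rpow_natCast,
          ← Real.rpow_mul (by positivity), ← Real.rpow_neg (by positivity)]
        congr 1
        push_cast
        ring
      rw [← ofReal_norm, ← ENNReal.ofReal_pow (norm_nonneg _), hd,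
        ← ENNReal.ofReal_mul (by positivity)]
      refine ENNReal.ofReal_le_ofReal ?_
      rw [mul_inv_le_iff₀ (by positivity), mul_assoc C,
        ← Real.mul_rpow (by positivity) (by positivity)]
      gcongr
      nlinarith [Real.pi_gt_three, sq_nonneg ‖ξ‖]
    refine ne_top_of_le_ne_top
      (b := ENNReal.ofReal (C * ((2 * Real.pi) ^ 2) ^ s) * ‖g‖ₑ ^ 2)
      (ENNReal.mul_ne_top ENNReal.ofReal_ne_top (by simp)) ?_
    calc _ = ∑' m : ℕ, ∫⁻ ξ, ENNReal.ofReal (4 ^ s) ^ m *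
          (ENNReal.ofReal (min 4 ((2 * Real.pi * ‖ξ‖ / 2 ^ m) ^ 2)) * ‖(𝓕 f : L2 n) ξ‖ₑ ^ 2) := by
          refine tsum_congr fun m => (lintegral_const_mul'' _ (hmeas m)).symm
      _ = ∫⁻ ξ, ∑' m : ℕ, ENNReal.ofReal (4 ^ s) ^ m *
          (ENNReal.ofReal (min 4 ((2 * Real.pi * ‖ξ‖ / 2 ^ m) ^ 2)) * ‖(𝓕 f : L2 n) ξ‖ₑ ^ 2) :=
          (lintegral_tsum fun m => (hmeas m).const_mul _).symm
      _ ≤ ∫⁻ ξ, ENNReal.ofReal (C * ((2 * Real.pi) ^ 2) ^ s) * ‖g ξ‖ₑ ^ 2 := lintegral_mono_ae hle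
      _ = ENNReal.ofReal (C * ((2 * Real.pi) ^ 2) ^ s) * ‖g‖ₑ ^ 2 := by
          rw [lintegral_const_mul' _ _ ENNReal.ofReal_ne_top, lintegral_enorm_sq]
  obtain ⟨u, hu, hu', hlim⟩ := exists_version_isLittleO
    (fun t => (Lp.stronglyMeasurable (propagator t f)).measurable)
    (lintegral_propagator_sub_le f) hs hsum
  refine ⟨u, ⟨hu, hu'⟩, ?_⟩
  rwa [propagator_zero] at hlim

theorem convergesWithRate_of_half_lt {δ s : ℝ} (hδ : δ < 1) (hs : 1 / 2 < s) (hδs : δ ≤ s)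
    {f : L2 n} (hf : MemH s f) : ConvergesWithRate δ f := by
  -- an exponent `σ ∈ (1/2, 1)` with `δ ≤ σ ≤ s`
  obtain ⟨σ, h1, h2, h3, h4⟩ : ∃ σ, 1 / 2 < σ ∧ σ < 1 ∧ δ ≤ σ ∧ σ ≤ s := by
    refine ⟨max δ (min s (3 / 4)), ?_, ?_, le_max_left _ _, max_le hδs (min_le_left _ _)⟩
    · exact lt_max_of_lt_right (lt_min hs (by norm_num))
    · exact max_lt hδ ((min_le_right _ _).trans_lt (by norm_num))
  exact (convergesWithRate_of_memH h1 h2 (hf.mono h4)).mono h3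

/-! ### Comparison of the evolution with a translation -/

/-- The character `ξ ↦ e^{2πi⟨ξ,v⟩}`, the symbol of the translation by `v`. -/
noncomputable def character (v ξ : Space n) : ℂ :=
  Complex.exp (((2 * Real.pi * inner ℝ ξ v : ℝ) : ℂ) * Complex.I)

theorem continuous_character (v : Space n) : Continuous (character v) := by
  unfold character
  fun_prop

theorem norm_character (v ξ : Space n) : ‖character v ξ‖ = 1 :=
  Complex.norm_exp_ofReal_mul_I _

theorem memLp_top_character (v : Space n) :
    MemLp (character v) ∞ (volume : Measure (Space n)) :=
  memLp_top_of_norm_le_one (continuous_character v).measurable fun ξ => (norm_character v ξ).le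

/-- The translation `f ↦ f(· + v)` of `L²`. -/
noncomputable def translate (v : Space n) : L2 n →ₗᵢ[ℂ] L2 n :=
  Lp.compMeasurePreservingₗᵢ ℂ (fun x => x + v) (measurePreserving_add_right volume v)

theorem translate_ae_eq (v : Space n) (f : L2 n) :
    translate v f =ᵐ[volume] fun x => f (x + v) :=
  Lp.coeFn_compMeasurePreserving f (measurePreserving_add_right volume v)

theorem fourierInv_eq_integral_character (G : Space n → ℂ) (x : Space n) :
    𝓕⁻ G x = ∫ ξ, character x ξ * G ξ := Real.fourierInv_eq' G x

theorem fourierInv_mulL_character_toLp (v : Space n) {G : Space n → ℂ} (h1 : Integrable G)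
    (h2 : MemLp G 2 (volume : Measure (Space n))) :
    (𝓕⁻ (mulL (memLp_top_character v) (h2.toLp G)) : L2 n)
      = translate v (𝓕⁻ (h2.toLp G : L2 n)) := by
  have hbd : ∀ᵐ ξ : Space n, ‖character v ξ‖ ≤ 1 :=
    Eventually.of_forall fun ξ => (norm_character v ξ).le
  have h1' : Integrable (fun ξ => character v ξ * G ξ) :=
    h1.bdd_mul (continuous_character v).aestronglyMeasurable hbd
  have h2' : MemLp (fun ξ => character v ξ * G ξ) 2 (volume : Measure (Space n)) :=
    h2.of_le ((continuous_character v).aestronglyMeasurable.mul h2.aestronglyMeasurable)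
      (Eventually.of_forall fun ξ => by rw [norm_mul, norm_character, one_mul])
  have heq : mulL (memLp_top_character v) (h2.toLp G) = h2'.toLp _ := by
    refine Lp.ext ?_
    filter_upwards [mulL_ae_eq (memLp_top_character v) (h2.toLp G), h2.coeFn_toLp,
      h2'.coeFn_toLp] with ξ e1 e2 e3
    rw [e1, e2, e3]
  rw [heq]
  refine Lp.ext ?_
  filter_upwards [fourierInv_toLp_ae_eq h1' h2', translate_ae_eq v (𝓕⁻ (h2.toLp G : L2 n)),
    (measurePreserving_add_right volume v).quasiMeasurePreserving.ae
      (fourierInv_toLp_ae_eq h1 h2)] with x e1 e2 e3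
  rw [e1, e2, e3, fourierInv_eq_integral_character, fourierInv_eq_integral_character]
  refine integral_congr_ae (Eventually.of_forall fun ξ => ?_)
  simp only [character]
  rw [← mul_assoc, ← Complex.exp_add, inner_add_right]
  congr 2
  push_cast
  ring

/-- The Fourier multiplier with symbol `e^{2πi⟨ξ,v⟩}` is the translation by `v`. -/
theorem fourierInv_mulL_character (v : Space n) (G : L2 n) :
    (𝓕⁻ (mulL (memLp_top_character v) G) : L2 n) = translate v (𝓕⁻ G) := by
  refine Lp.induction (by norm_num)
    (motive := fun G : L2 n =>
      (𝓕⁻ (mulL (memLp_top_character v) G) : L2 n) = translate v (𝓕⁻ G)) ?_ ?_ ?_ G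
  · intro c s hs hμs
    rw [Lp.simpleFunc.coe_indicatorConst]
    exact fourierInv_mulL_character_toLp v
      ((integrable_indicator_iff hs).2 (integrableOn_const hμs.ne)) _
  · intro f g hf hg _ e1 e2
    rw [map_add, fourierInv_add, e1, e2, fourierInv_add, map_add]
  · refine isClosed_eq ?_ ?_
    · exact (Lp.fourierTransformₗᵢ (Space n) ℂ).symm.continuous.comp (mulL _).continuous
    · exact (translate v).continuous.comp (Lp.fourierTransformₗᵢ (Space n) ℂ).symm.continuous

theorem norm_sub_inner_nonneg {e : Space n} (he : ‖e‖ = 1) (ξ : Space n) :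
    0 ≤ ‖ξ‖ - inner ℝ ξ e := by
  have := real_inner_le_norm ξ e
  rw [he, mul_one] at this
  linarith

/-- If the Fourier transform of `f` is concentrated near the ray spanned by the unit vector `e`,
then `e^{it√(-Δ)} f` is the translation of `f` by `t e` up to `O(t)`. -/
theorem ae_norm_propagator_sub_le {f : L2 n} {e : Space n} (he : ‖e‖ = 1)
    (hint : Integrable fun ξ => (‖ξ‖ - inner ℝ ξ e) * ‖(𝓕 f : L2 n) ξ‖) (t : ℝ) :
    ∀ᵐ x, ‖propagator t f x - f (x + t • e)‖
      ≤ (2 * Real.pi * ∫ ξ, (‖ξ‖ - inner ℝ ξ e) * ‖(𝓕 f : L2 n) ξ‖) * |t| := by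
  have hpos := norm_sub_inner_nonneg he
  have hsymb : ∀ ξ : Space n, ‖symbol t ξ - character (t • e) ξ‖
      ≤ 2 * Real.pi * |t| * (‖ξ‖ - inner ℝ ξ e) := fun ξ => by
    refine (norm_exp_mul_I_sub_le _ _).trans_eq ?_
    rw [inner_smul_right, show 2 * Real.pi * ‖ξ‖ * t - 2 * Real.pi * (t * inner ℝ ξ e)
      = (2 * Real.pi) * t * (‖ξ‖ - inner ℝ ξ e) by ring, abs_mul, abs_mul, abs_of_nonneg (hpos ξ),
      abs_of_nonneg (by positivity)]
  set D : L2 n := mulL (memLp_top_symbol t) (𝓕 f) - mulL (memLp_top_character (t • e)) (𝓕 f)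
    with hD
  have hDae : D =ᵐ[volume] fun ξ => (symbol t ξ - character (t • e) ξ) * (𝓕 f : L2 n) ξ := by
    filter_upwards [Lp.coeFn_sub (mulL (memLp_top_symbol t) (𝓕 f))
      (mulL (memLp_top_character (t • e)) (𝓕 f)), mulL_ae_eq (memLp_top_symbol t) (𝓕 f),
      mulL_ae_eq (memLp_top_character (t • e)) (𝓕 f)] with ξ e1 e2 e3
    rw [hD, e1, Pi.sub_apply, e2, e3, sub_mul]
  have hDle : ∀ᵐ ξ, ‖D ξ‖ ≤ 2 * Real.pi * |t| * ((‖ξ‖ - inner ℝ ξ e) * ‖(𝓕 f : L2 n) ξ‖) := by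
    filter_upwards [hDae] with ξ h
    rw [h, norm_mul, ← mul_assoc]
    gcongr
    exact hsymb ξ
  have hDint : Integrable D :=
    (hint.const_mul _).mono' (Lp.aestronglyMeasurable D) hDle
  have hdiff : propagator t f - translate (t • e) f = 𝓕⁻ D := by
    rw [propagator_eq, hD, fourierInv_sub, fourierInv_mulL_character, fourierInv_fourier_eq]
  have hrep := fourierInv_toLp_ae_eq hDint (Lp.memLp D)
  rw [Lp.toLp_coeFn, ← hdiff] at hrep
  filter_upwards [hrep, Lp.coeFn_sub (propagator t f) (translate (t • e) f),
    translate_ae_eq (t • e) f] with x e1 e2 e3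
  rw [← e3, ← Pi.sub_apply, ← e2, e1, fourierInv_eq_integral_character]
  refine (norm_integral_le_of_norm_le (hint.const_mul (2 * Real.pi * |t|)) ?_).trans_eq ?_
  · filter_upwards [hDle] with ξ h
    rwa [norm_mul, norm_character, one_mul]
  · rw [integral_const_mul]
    ring

/-! ### Oscillation along lines -/

/-- The points at which `f` oscillates by at most `C |t|^δ` along the direction `e`, at almost every
time `|t| < η`. -/
def slowSet (f : Space n → ℂ) (e : Space n) (δ η C : ℝ) : Set (Space n) :=
  {x | ∀ᵐ t : ℝ, |t| < η → ‖f (x + t • e) - f x‖ ≤ C * |t| ^ δ}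

theorem measurableSet_slowSet {f : Space n → ℂ} (hf : Measurable f) (e : Space n) (δ η C : ℝ) :
    MeasurableSet (slowSet f e δ η C) := by
  have hS : MeasurableSet {p : Space n × ℝ |
      ¬ (|p.2| < η → ‖f (p.1 + p.2 • e) - f p.1‖ ≤ C * |p.2| ^ δ)} := by
    refine MeasurableSet.compl ?_
    refine MeasurableSet.imp (measurableSet_lt (by fun_prop) (by fun_prop)) ?_
    refine measurableSet_le ?_ ?_
    · exact ((hf.comp (by fun_prop)).sub (hf.comp measurable_fst)).norm
    · fun_prop
  exact (measurable_measure_prodMk_left (ν := (volume : Measure ℝ)) hS)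
    (measurableSet_singleton 0)

theorem slowSet_mono {f : Space n → ℂ} {e : Space n} {δ η η' C C' : ℝ} (hη : η' ≤ η)
    (hC : C ≤ C') : slowSet f e δ η C ⊆ slowSet f e δ η' C' := by
  intro x hx
  change ∀ᵐ t : ℝ, |t| < η' → _
  filter_upwards [hx] with t ht h
  exact (ht (h.trans_le hη)).trans (by gcongr)

/-- A property of almost every point holds at almost every point of almost every line parallel to
`e`. -/
theorem ae_ae_line {P : Space n → Prop} (hP : ∀ᵐ x, P x) (e : Space n) :
    ∀ᵐ x : Space n, ∀ᵐ t : ℝ, P (x + t • e) := by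
  obtain ⟨S, hS, hSm, hSP⟩ := hP.exists_measurable_mem
  have h : ∀ᵐ x : Space n, ∀ᵐ t : ℝ, x + t • e ∈ S := by
    rw [Measure.ae_ae_comm]
    · refine Eventually.of_forall fun t => ?_
      exact (measurePreserving_add_right volume (t • e)).quasiMeasurePreserving.ae hS
    · exact (show Measurable fun p : Space n × ℝ => p.1 + p.2 • e by fun_prop) hSm
  filter_upwards [h] with x hx
  filter_upwards [hx] with t ht using hSP _ ht

/-- A convergence rate for the half-wave evolution passes to the translations of `f`. -/
theorem ConvergesWithRate.ae_exists_mem_slowSet {δ : ℝ} (hδ : δ < 1) {f : L2 n}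
    (h : ConvergesWithRate δ f) {e : Space n} {K : ℝ}
    (hK : ∀ t : ℝ, ∀ᵐ x, ‖propagator t f x - f (x + t • e)‖ ≤ K * |t|) :
    ∀ᵐ x, ∃ N : ℕ, x ∈ slowSet f e δ (1 / (N + 1)) N := by
  obtain ⟨u, hu, hlim⟩ := h
  have hf : Measurable f := (Lp.stronglyMeasurable f).measurable
  have hline : ∀ᵐ x, ∀ᵐ t : ℝ, ‖u x t - f (x + t • e)‖ ≤ K * |t| := by
    rw [Measure.ae_ae_comm]
    · refine Eventually.of_forall fun t => ?_
      filter_upwards [hu.ae_eq t, hK t] with x e1 e2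
      rwa [e1]
    · refine measurableSet_le ?_ (by fun_prop)
      exact (hu.measurable.sub (hf.comp (by fun_prop))).norm
  filter_upwards [hline, hlim] with x h1 h2
  obtain ⟨r, hr, hball⟩ := Metric.eventually_nhds_iff.1
    (eventually_nhdsWithin_iff.1 (h2.bound one_pos))
  obtain ⟨N, hN⟩ := exists_nat_gt (max (1 / r) (1 + |K|))
  have hN0 : (0 : ℝ) < N := lt_of_lt_of_le (by positivity) ((le_max_right _ _).trans hN.le)
  refine ⟨N, ?_⟩
  filter_upwards [h1, Measure.ae_ne volume 0] with t e1 ht0 ht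
  have htr : |t| < r := by
    refine ht.trans ?_
    rw [one_div_lt (by positivity) hr]
    linarith [le_max_left (1 / r) (1 + |K|)]
  have e2 := hball (y := t) (by rwa [dist_zero_right]) ht0
  rw [one_mul, Real.norm_of_nonneg (by positivity)] at e2
  have ht1 : |t| ≤ |t| ^ δ := by
    have : |t| ≤ 1 := by
      refine ht.le.trans ?_
      rw [div_le_one (by positivity)]
      linarith
    calc |t| = |t| ^ (1 : ℝ) := (Real.rpow_one _).symm
      _ ≤ |t| ^ δ := Real.rpow_le_rpow_of_exponent_ge (abs_pos.2 ht0) this hδ.le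
  calc ‖f (x + t • e) - f x‖ = ‖(u x t - f x) - (u x t - f (x + t • e))‖ := by congr 1; ring
    _ ≤ |t| ^ δ + |K| * |t| :=
        (norm_sub_le _ _).trans (add_le_add e2 (e1.trans (by gcongr; exact le_abs_self K)))
    _ ≤ |t| ^ δ + |K| * |t| ^ δ := by gcongr
    _ = (1 + |K|) * |t| ^ δ := by ring
    _ ≤ N * |t| ^ δ := by
        gcongr
        linarith [le_max_right (1 / r) (1 + |K|)]

/-- `L²` limits preserve bounds for the size of the set of fast oscillation: along an almost
everywhere convergent subsequence, a point outside the slow set of the limit is eventually outside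
the slow sets of the sequence. -/
theorem isClosed_measure_diff_slowSet_le (B : Set (Space n)) (e : Space n) (δ η C : ℝ) (c : ℝ≥0∞) :
    IsClosed {f : L2 n | volume (B \ slowSet f e δ η C) ≤ c} := by
  refine IsSeqClosed.isClosed fun F f hF hlim => ?_
  obtain ⟨k, -, hk⟩ := (tendstoInMeasure_of_tendsto_Lp hlim).exists_seq_tendsto_ae
  have hsub : (B \ slowSet f e δ η C : Set (Space n)) ≤ᵐ[volume]
      ⋃ M : ℕ, ⋂ m ≥ M, B \ slowSet (F (k m)) e δ η C := by
    filter_upwards [hk, ae_ae_line hk e] with x h1 h2 hx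
    obtain ⟨hxB, hxs⟩ := hx
    by_contra hcon
    have hfreq : ∃ᶠ m in atTop, x ∈ slowSet (F (k m)) e δ η C := by
      rw [frequently_atTop]
      intro M
      by_contra! hM
      exact hcon (Set.mem_iUnion.2 ⟨M, Set.mem_iInter₂.2 fun m hm => ⟨hxB, hM m hm⟩⟩)
    refine hxs ?_
    have hall : ∀ᵐ t : ℝ, ∀ m, x ∈ slowSet (F (k m)) e δ η C →
        |t| < η → ‖F (k m) (x + t • e) - F (k m) x‖ ≤ C * |t| ^ δ := by
      rw [ae_all_iff]
      intro m
      by_cases hm : x ∈ slowSet (F (k m)) e δ η C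
      · filter_upwards [hm] with t ht _ using ht
      · exact Eventually.of_forall fun t h => absurd h hm
    filter_upwards [h2, hall] with t e1 e2 ht
    refine le_of_tendsto_of_frequently (e1.sub h1).norm (hfreq.mono fun m hm => e2 m hm ht)
  refine (measure_mono_ae hsub).trans ?_
  rw [Monotone.measure_iUnion]
  · refine iSup_le fun M => (measure_mono ?_).trans (hF (k M))
    exact Set.iInter₂_subset M le_rfl
  · intro M M' hM
    exact Set.biInter_subset_biInter_left fun m (hm : M' ≤ m) => hM.trans hm

/-- A uniform version of an almost everywhere bound on oscillations, from Baire's theorem: if every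
function in the range of `T` oscillates slowly at almost every point, then the functions `T g` with
`g` in some ball have a common bound for their oscillation, each off a small part of `B`. -/
theorem exists_uniform_slowSet (T : L2 n →L[ℂ] L2 n) {e : Space n} {δ : ℝ}
    (hT : ∀ g, ∀ᵐ x, ∃ N : ℕ, x ∈ slowSet (T g) e δ (1 / (N + 1)) N)
    {B : Set (Space n)} (hB : MeasurableSet B) (hB0 : volume B ≠ 0) (hBtop : volume B ≠ ∞) :
    ∃ ρ > 0, ∃ N : ℕ, ∀ g : L2 n, ‖g‖ < ρ → ∀ P : Space n → Prop, (∀ᵐ x, P x) →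
      ∃ x ∈ B, P x ∧ x ∈ slowSet (T g) e δ (1 / (N + 1)) (2 * N) := by
  set F : ℕ → Set (L2 n) := fun N =>
    {g | volume (B \ slowSet (T g) e δ (1 / (N + 1)) N) ≤ volume B / 3} with hF
  have hmono : ∀ g, Monotone fun N : ℕ => slowSet (T g) e δ (1 / (N + 1)) N := by
    intro g N N' h
    have h' : (N : ℝ) ≤ N' := by exact_mod_cast h
    exact slowSet_mono (by gcongr) h'
  have hclosed : ∀ N, IsClosed (F N) := fun N =>
    (isClosed_measure_diff_slowSet_le B e δ _ _ _).preimage T.continuous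
  have hunion : ⋃ N, F N = Set.univ := by
    refine Set.eq_univ_of_forall fun g => ?_
    have hm : Measurable (T g) := (Lp.stronglyMeasurable (T g)).measurable
    have hlim := tendsto_measure_iInter_atTop (μ := (volume : Measure (Space n)))
      (s := fun N : ℕ => B \ slowSet (T g) e δ (1 / (N + 1)) N)
      (fun N => (hB.diff (measurableSet_slowSet hm e δ _ _)).nullMeasurableSet)
      (fun N N' h => Set.sdiff_subset_sdiff_right (hmono g h))
      ⟨0, measure_ne_top_of_subset Set.sdiff_subset hBtop⟩
    have hnull : volume (⋂ N : ℕ, B \ slowSet (T g) e δ (1 / (N + 1)) N) = 0 := by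
      refine measure_mono_null (fun x hx => ?_) (ae_iff.1 (hT g))
      rintro ⟨N, hN⟩
      exact (Set.mem_iInter.1 hx N).2 hN
    rw [hnull] at hlim
    obtain ⟨N, hN⟩ := (hlim.eventually (ge_mem_nhds (ENNReal.div_pos hB0 (by norm_num :
      (3 : ℝ≥0∞) ≠ ∞)))).exists
    exact Set.mem_iUnion.2 ⟨N, hN⟩
  obtain ⟨N, g₀, hg₀⟩ := nonempty_interior_of_iUnion_of_closed hclosed hunion
  obtain ⟨ρ, hρ, hball⟩ := Metric.mem_nhds_iff.1 (mem_interior_iff_mem_nhds.1 hg₀)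
  refine ⟨ρ, hρ, N, fun g hg P hP => ?_⟩
  have h1 : g + g₀ ∈ F N := hball (by simpa using hg)
  have h0 : g₀ ∈ F N := hball (Metric.mem_ball_self hρ)
  by_contra! hcon
  have hsub : (B : Set (Space n)) ≤ᵐ[volume] ((B \ slowSet (T (g + g₀)) e δ (1 / (N + 1)) N) ∪
      (B \ slowSet (T g₀) e δ (1 / (N + 1)) N) : Set (Space n)) := by
    have hadd : ∀ᵐ x, T (g + g₀) x = T g x + T g₀ x := by
      rw [map_add]
      exact Lp.coeFn_add _ _
    filter_upwards [hP, hadd, ae_ae_line hadd e] with x hPx hx hxt hxB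
    have hns := hcon x hxB hPx
    by_contra hmem
    change ¬ (x ∈ (_ ∪ _ : Set (Space n))) at hmem
    simp only [Set.mem_union, Set.mem_sdiff, not_or, not_and, not_not] at hmem
    have hxB' : x ∈ B := hxB
    refine hns ?_
    change ∀ᵐ t : ℝ, |t| < 1 / ((N : ℝ) + 1) → _
    filter_upwards [hxt, hmem.1 hxB', hmem.2 hxB'] with t e1 e2 e3 ht
    calc ‖T g (x + t • e) - T g x‖
        = ‖(T (g + g₀) (x + t • e) - T (g + g₀) x) - (T g₀ (x + t • e) - T g₀ x)‖ := by
          rw [e1, hx]; congr 1; ring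
      _ ≤ N * |t| ^ δ + N * |t| ^ δ := (norm_sub_le _ _).trans (add_le_add (e2 ht) (e3 ht))
      _ = 2 * N * |t| ^ δ := by ring
  have hle : volume B ≤ volume B / 3 + volume B / 3 :=
    (measure_mono_ae hsub).trans ((measure_union_le _ _).trans (add_le_add h1 h0))
  have hpos : 0 < (volume B).toReal := ENNReal.toReal_pos hB0 hBtop
  have h3 : volume B / 3 ≠ ∞ := ENNReal.div_ne_top hBtop (by norm_num)
  have := ENNReal.toReal_mono (ENNReal.add_ne_top.2 ⟨h3, h3⟩) hle
  rw [ENNReal.toReal_add h3 h3, ENNReal.toReal_div] at this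
  norm_num at this
  linarith

/-! ### Functions with frequencies along a ray -/

/-- The union of the balls of radius `1/2` about the points `e, 2e, 3e, …`. -/
def beam (e : Space n) : Set (Space n) := ⋃ k : ℕ, Metric.ball (((k : ℝ) + 1) • e) (1 / 2)

theorem measurableSet_beam (e : Space n) : MeasurableSet (beam e) :=
  MeasurableSet.iUnion fun _ => measurableSet_ball

/-- On the beam the symbols `|ξ|` and `⟨ξ, e⟩` differ by `O(1/|ξ|)`. -/
theorem norm_sub_inner_le_of_mem_ball {e : Space n} (he : ‖e‖ = 1) {k : ℝ} (hk : 1 ≤ k)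
    {ξ : Space n} (hξ : ξ ∈ Metric.ball (k • e) (1 / 2)) : ‖ξ‖ - inner ℝ ξ e ≤ 1 / k := by
  have h0 := norm_sub_inner_nonneg he ξ
  rw [mem_ball_iff_norm] at hξ
  have h1 : ‖ξ - k • e‖ ^ 2 = ‖ξ‖ ^ 2 - 2 * k * inner ℝ ξ e + k ^ 2 := by
    rw [norm_sub_sq_real, inner_smul_right, norm_smul, he, mul_one, Real.norm_eq_abs, sq_abs]
    ring
  have h2 : |inner ℝ ξ e - k| < 1 / 2 := by
    have : inner ℝ ξ e - k = inner ℝ (ξ - k • e) e := by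
      rw [inner_sub_left, inner_smul_left, real_inner_self_eq_norm_sq, he]
      simp
    rw [this]
    refine (abs_real_inner_le_norm _ _).trans_lt ?_
    rwa [he, mul_one]
  rw [abs_lt] at h2
  have h3 : ‖ξ - k • e‖ ^ 2 ≤ 1 := by nlinarith [norm_nonneg (ξ - k • e)]
  rw [le_div_iff₀ (by linarith)]
  nlinarith [sq_nonneg (inner ℝ ξ e - k)]

/-- The difference of the symbols is square integrable over the beam, since `∑ k⁻²` converges; it is
therefore integrable against every function of `L²`. -/
theorem memLp_two_norm_sub_inner {e : Space n} (he : ‖e‖ = 1) :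
    MemLp ((beam e).indicator fun ξ : Space n => ‖ξ‖ - inner ℝ ξ e) 2
      (volume : Measure (Space n)) := by
  have hm : Measurable fun ξ : Space n => ‖ξ‖ - inner ℝ ξ e := by fun_prop
  refine ⟨(hm.indicator (measurableSet_beam e)).aestronglyMeasurable, ?_⟩
  rw [eLpNorm_lt_top_iff_lintegral_rpow_enorm_lt_top (by norm_num) (by norm_num)]
  have hV : volume (Metric.ball (0 : Space n) (1 / 2)) ≠ ∞ := measure_ball_lt_top.ne
  calc ∫⁻ ξ, ‖(beam e).indicator (fun ξ : Space n => ‖ξ‖ - inner ℝ ξ e) ξ‖ₑ ^ (ENNReal.toReal 2)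
      = ∫⁻ ξ in beam e, ‖‖ξ‖ - inner ℝ ξ e‖ₑ ^ 2 := by
        rw [← lintegral_indicator (measurableSet_beam e)]
        refine lintegral_congr fun ξ => ?_
        by_cases h : ξ ∈ beam e <;> simp [h]
    _ ≤ ∑' k : ℕ, ∫⁻ ξ in Metric.ball (((k : ℝ) + 1) • e) (1 / 2), ‖‖ξ‖ - inner ℝ ξ e‖ₑ ^ 2 :=
        lintegral_iUnion_le _ _
    _ ≤ ∑' k : ℕ, ENNReal.ofReal (1 / ((k : ℝ) + 1) ^ 2) *
          volume (Metric.ball (0 : Space n) (1 / 2)) := by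
        refine ENNReal.tsum_le_tsum fun k => ?_
        rw [← Measure.addHaar_ball_center volume (((k : ℝ) + 1) • e) (1 / 2), ← setLIntegral_const]
        refine setLIntegral_mono measurable_const fun ξ hξ => ?_
        have h1 := norm_sub_inner_le_of_mem_ball he (k := (k : ℝ) + 1)
          (by linarith [k.cast_nonneg (α := ℝ)]) hξ
        have h0 := norm_sub_inner_nonneg he ξ
        rw [Real.enorm_of_nonneg h0, ← ENNReal.ofReal_pow h0, ← one_div_pow]
        gcongr
    _ = (∑' k : ℕ, ENNReal.ofReal (1 / ((k : ℝ) + 1) ^ 2)) *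
          volume (Metric.ball (0 : Space n) (1 / 2)) := ENNReal.tsum_mul_right
    _ < ∞ := by
        refine ENNReal.mul_lt_top ?_ hV.lt_top
        have hs : Summable fun k : ℕ => 1 / ((k : ℝ) + 1) ^ 2 := by
          have := (summable_nat_add_iff 1).2 (Real.summable_one_div_nat_pow.2 one_lt_two)
          simpa using this
        exact (hs.tsum_ofReal_lt_top)

theorem memLp_top_beam (e : Space n) :
    MemLp ((beam e).indicator fun _ => (1 : ℂ)) ∞ (volume : Measure (Space n)) :=
  memLp_top_of_norm_le_one (measurable_const.indicator (measurableSet_beam e)) fun ξ => by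
    by_cases h : ξ ∈ beam e <;> simp [h]

/-- The operator whose values are the functions of `H^s` with Fourier transform supported in the
beam along `e`, parametrized by `L²`. -/
noncomputable def beamOp (e : Space n) {s : ℝ} (hs : 0 ≤ s) : L2 n →L[ℂ] L2 n :=
  fourierInvCLM ℂ (L2 n) ∘L mulL (memLp_top_decay hs) ∘L mulL (memLp_top_beam e)

theorem beamOp_apply (e : Space n) {s : ℝ} (hs : 0 ≤ s) (g : L2 n) :
    beamOp e hs g = 𝓕⁻ (mulL (memLp_top_decay hs) (mulL (memLp_top_beam e) g)) := rfl

theorem memH_beamOp (e : Space n) {s : ℝ} (hs : 0 ≤ s) (g : L2 n) : MemH s (beamOp e hs g) :=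
  (memH_iff hs _).2 ⟨mulL (memLp_top_beam e) g, by rw [beamOp_apply, fourier_fourierInv_eq]⟩

theorem integrable_beamOp {e : Space n} (he : ‖e‖ = 1) {s : ℝ} (hs : 0 ≤ s) (g : L2 n) :
    Integrable fun ξ => (‖ξ‖ - inner ℝ ξ e) * ‖(𝓕 (beamOp e hs g) : L2 n) ξ‖ := by
  refine ((memLp_two_norm_sub_inner he).integrable_mul
    (Lp.memLp (𝓕 (beamOp e hs g) : L2 n)).norm).congr ?_
  rw [beamOp_apply, fourier_fourierInv_eq]
  filter_upwards [mulL_ae_eq (memLp_top_decay hs) (mulL (memLp_top_beam e) g),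
    mulL_ae_eq (memLp_top_beam e) g] with ξ e1 e2
  rw [Pi.mul_apply, e1, e2]
  by_cases h : ξ ∈ beam e <;> simp [h]

/-! ### Focusing wave trains -/

/-- The indicator function of the ball of radius `1/2` about `v`. -/
noncomputable def bump (v : Space n) : Space n → ℂ :=
  (Metric.ball v (1 / 2)).indicator fun _ => 1

theorem bump_of_mem {v ξ : Space n} (h : ξ ∈ Metric.ball v (1 / 2)) : bump v ξ = 1 :=
  Set.indicator_of_mem h _

theorem bump_of_notMem {v ξ : Space n} (h : ξ ∉ Metric.ball v (1 / 2)) : bump v ξ = 0 :=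
  Set.indicator_of_notMem h _

theorem integrable_bump (v : Space n) : Integrable (bump v) :=
  (integrable_indicator_iff measurableSet_ball).2 (integrableOn_const measure_ball_lt_top.ne)

theorem memLp_bump (v : Space n) : MemLp (bump v) 2 (volume : Measure (Space n)) :=
  memLp_indicator_const 2 measurableSet_ball 1 (Or.inr measure_ball_lt_top.ne)

/-- Translation of the frequency is modulation. -/
theorem fourierInv_bump (v x : Space n) :
    𝓕⁻ (bump v) x = character x v * 𝓕⁻ (bump (0 : Space n)) x := by
  rw [fourierInv_eq_integral_character, fourierInv_eq_integral_character, ← integral_const_mul,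
    ← integral_add_right_eq_self _ v]
  refine integral_congr_ae (Eventually.of_forall fun ξ => ?_)
  have h1 : bump v (ξ + v) = bump 0 ξ := by
    simp only [bump, Set.indicator, mem_ball_iff_norm, add_sub_cancel_right, sub_zero]
  simp only [h1, character]
  rw [← mul_assoc, ← Complex.exp_add, inner_add_left]
  congr 2
  push_cast
  ring

/-- The low frequency profile is bounded below near the origin. -/
theorem re_fourierInv_bump_zero_ge {x : Space n} (hx : ‖x‖ ≤ 1 / 4) :
    volume.real (Metric.ball (0 : Space n) (1 / 2)) / 2 ≤ (𝓕⁻ (bump (0 : Space n)) x).re := by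
  have hint : Integrable fun ξ => character x ξ * bump 0 ξ :=
    (integrable_bump 0).bdd_mul (continuous_character x).aestronglyMeasurable
      (Eventually.of_forall fun ξ => (norm_character x ξ).le)
  rw [fourierInv_eq_integral_character]
  have h1 : (∫ ξ, character x ξ * bump 0 ξ).re = ∫ ξ, (character x ξ * bump 0 ξ).re :=
    (integral_re hint).symm
  have h2 : volume.real (Metric.ball (0 : Space n) (1 / 2)) / 2
      = ∫ ξ, (Metric.ball (0 : Space n) (1 / 2)).indicator (fun _ => (1 / 2 : ℝ)) ξ := by
    rw [integral_indicator_const _ measurableSet_ball, smul_eq_mul]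
    ring
  rw [h1, h2]
  refine integral_mono ((integrable_indicator_iff measurableSet_ball).2
    (integrableOn_const measure_ball_lt_top.ne)) hint.re fun ξ => ?_
  by_cases hξ : ξ ∈ Metric.ball (0 : Space n) (1 / 2)
  · have hξ' : ‖ξ‖ ≤ 1 / 2 := by simpa using! (mem_ball_zero_iff.1 hξ).le
    have hin : |2 * Real.pi * inner ℝ ξ x| ≤ 1 := by
      rw [abs_mul, abs_of_pos Real.two_pi_pos]
      have := (abs_real_inner_le_norm ξ x).trans
        (mul_le_mul hξ' hx (norm_nonneg _) (by norm_num))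
      nlinarith [Real.pi_lt_four, Real.pi_pos]
    rw [bump_of_mem hξ, Set.indicator_of_mem hξ, mul_one, character]
    rw [Complex.exp_ofReal_mul_I_re]
    have := Real.one_sub_sq_div_two_le_cos (x := 2 * Real.pi * inner ℝ ξ x)
    have h3 : (2 * Real.pi * inner ℝ ξ x) ^ 2 ≤ 1 := by
      rw [← sq_abs]; exact pow_le_one₀ (abs_nonneg _) hin
    linarith
  · simp only [bump_of_notMem hξ, Set.indicator_of_notMem hξ, mul_zero, Complex.zero_re, le_refl]

/-- A superposition of bumps at the odd multiples of `R e`, with coefficients `1, 1/3, 1/5, …`. -/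
noncomputable def comb (e : Space n) (R J : ℕ) (ξ : Space n) : ℂ :=
  ∑ j ∈ Finset.range J, ((1 / (2 * j + 1) : ℝ) : ℂ) * bump ((R * (2 * j + 1) : ℝ) • e) ξ

theorem fourierInv_comb (e : Space n) (R J : ℕ) (x : Space n) :
    𝓕⁻ (comb e R J) x = (∑ j ∈ Finset.range J, ((1 / (2 * j + 1) : ℝ) : ℂ) *
      character x ((R * (2 * j + 1) : ℝ) • e)) * 𝓕⁻ (bump (0 : Space n)) x := by
  rw [fourierInv_eq_integral_character, Finset.sum_mul]
  simp only [comb, Finset.mul_sum]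
  rw [integral_finsetSum]
  · refine Finset.sum_congr rfl fun j _ => ?_
    rw [mul_assoc, ← fourierInv_bump, fourierInv_eq_integral_character, ← integral_const_mul]
    refine integral_congr_ae (Eventually.of_forall fun ξ => ?_)
    ring
  · intro j _
    exact ((integrable_bump _).const_mul _).bdd_mul (continuous_character x).aestronglyMeasurable
      (Eventually.of_forall fun ξ => (norm_character x ξ).le)

theorem integrable_comb (e : Space n) (R J : ℕ) : Integrable (comb e R J) :=
  integrable_finsetSum _ fun _ _ => (integrable_bump _).const_mul _

theorem memLp_comb (e : Space n) (R J : ℕ) : MemLp (comb e R J) 2 (volume : Measure (Space n)) :=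
  memLp_finsetSum _ fun _ _ => (memLp_bump _).const_mul _

theorem comb_eq_of_mem_ball {e : Space n} (he : ‖e‖ = 1) {R J i : ℕ} (hR : 1 ≤ R)
    (hi : i ∈ Finset.range J) {ξ : Space n}
    (hξ : ξ ∈ Metric.ball ((R * (2 * i + 1) : ℝ) • e) (1 / 2)) :
    comb e R J ξ = ((1 / (2 * i + 1) : ℝ) : ℂ) := by
  rw [comb, Finset.sum_eq_single_of_mem i hi]
  · rw [bump_of_mem hξ, mul_one]
  · intro j _ hji
    suffices h : ξ ∉ Metric.ball ((R * (2 * j + 1) : ℝ) • e) (1 / 2) by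
      rw [bump_of_notMem h, mul_zero]
    intro hj
    have h1 : dist ((R * (2 * i + 1) : ℝ) • e) ((R * (2 * j + 1) : ℝ) • e) < 1 := by
      have h2 := dist_triangle_left ((R * (2 * i + 1) : ℝ) • e) ((R * (2 * j + 1) : ℝ) • e) ξ
      have := Metric.mem_ball.1 hξ
      have := Metric.mem_ball.1 hj
      linarith
    rw [dist_eq_norm, ← sub_smul, norm_smul, he, mul_one, Real.norm_eq_abs] at h1
    have h2 : (R * (2 * i + 1) - R * (2 * j + 1) : ℝ) = ((R * (2 * ((i : ℤ) - j)) : ℤ) : ℝ) := by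
      push_cast; ring
    rw [h2, ← Int.cast_abs] at h1
    have h3 : |(R * (2 * ((i : ℤ) - j)) : ℤ)| < 1 := by exact_mod_cast h1
    rw [Int.abs_lt_one_iff] at h3
    have : (i : ℤ) - j = 0 := by
      rcases mul_eq_zero.1 h3 with h | h <;> omega
    omega

theorem comb_eq_zero {e : Space n} {R J : ℕ} {ξ : Space n}
    (h : ∀ i ∈ Finset.range J, ξ ∉ Metric.ball ((R * (2 * i + 1) : ℝ) • e) (1 / 2)) :
    comb e R J ξ = 0 :=
  Finset.sum_eq_zero fun i hi => by rw [bump_of_notMem (h i hi), mul_zero]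

theorem mem_beam_of_comb_ne_zero {e : Space n} {R J : ℕ} (hR : 1 ≤ R) {ξ : Space n}
    (h : comb e R J ξ ≠ 0) : ξ ∈ beam e := by
  contrapose! h
  refine comb_eq_zero fun i _ hi => h (Set.mem_iUnion.2 ⟨R * (2 * i + 1) - 1, ?_⟩)
  have h1 : 1 ≤ R * (2 * i + 1) := Nat.mul_pos hR (by omega)
  rw [Nat.cast_sub h1]
  push_cast
  rwa [sub_add_cancel]

theorem lintegral_comb_le {e : Space n} (he : ‖e‖ = 1) {s : ℝ} (hs : 0 ≤ s) {R : ℕ} (hR : 1 ≤ R)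
    (J : ℕ) {ε : ℝ} (hε : 0 ≤ ε) :
    ∫⁻ ξ, ‖(ε : ℂ) * (comb e R J ξ * (((1 + ‖ξ‖ ^ 2) ^ (s / 2) : ℝ) : ℂ))‖ₑ ^ 2
      ≤ ENNReal.ofReal (∑ j ∈ Finset.range J,
        (ε * (1 / (2 * j + 1))) ^ 2 * (4 * (R * (2 * j + 1)) ^ 2) ^ s) *
          volume (Metric.ball (0 : Space n) (1 / 2)) := by
  have hpt : ∀ ξ : Space n,
      ‖(ε : ℂ) * (comb e R J ξ * (((1 + ‖ξ‖ ^ 2) ^ (s / 2) : ℝ) : ℂ))‖ₑ ^ 2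
      ≤ ∑ j ∈ Finset.range J, (Metric.ball ((R * (2 * j + 1) : ℝ) • e) (1 / 2)).indicator
        (fun _ => ENNReal.ofReal
          ((ε * (1 / (2 * j + 1))) ^ 2 * (4 * (R * (2 * j + 1)) ^ 2) ^ s)) ξ := by
    intro ξ
    by_cases h : ∀ i ∈ Finset.range J, ξ ∉ Metric.ball ((R * (2 * i + 1) : ℝ) • e) (1 / 2)
    · simp [comb_eq_zero h]
    · push Not at h
      obtain ⟨i, hi, hξ⟩ := h
      refine le_trans ?_ (Finset.single_le_sum (fun _ _ => zero_le) hi)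
      rw [Set.indicator_of_mem hξ, comb_eq_of_mem_ball he hR hi hξ, ← ofReal_norm,
        ← ENNReal.ofReal_pow (norm_nonneg _)]
      refine ENNReal.ofReal_le_ofReal ?_
      set k : ℝ := R * (2 * i + 1) with hk
      have hk1 : 1 ≤ k := by
        have : (1 : ℝ) ≤ R := by exact_mod_cast hR
        have : (0 : ℝ) ≤ i := i.cast_nonneg
        nlinarith
      have hnorm : ‖ξ‖ ≤ k + 1 / 2 := by
        have h1 := norm_le_norm_add_norm_sub' ξ (k • e)
        rw [norm_smul, he, mul_one, Real.norm_of_nonneg (by linarith)] at h1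
        have h2 := mem_ball_iff_norm.1 hξ
        linarith
      rw [norm_mul, norm_mul, Complex.norm_real, Complex.norm_real, Complex.norm_real,
        Real.norm_of_nonneg hε, Real.norm_of_nonneg (by positivity),
        Real.norm_of_nonneg (by positivity), ← mul_assoc, mul_pow]
      gcongr
      rw [← Real.rpow_natCast, ← Real.rpow_mul (by positivity)]
      have h3 : s / 2 * ((2 : ℕ) : ℝ) = s := by push_cast; ring
      rw [h3]
      gcongr
      nlinarith [norm_nonneg ξ]
  refine (lintegral_mono hpt).trans ?_
  rw [lintegral_finsetSum _ fun j _ => measurable_const.indicator measurableSet_ball,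
    ENNReal.ofReal_sum_of_nonneg fun j _ => by positivity, Finset.sum_mul]
  refine Finset.sum_le_sum fun j _ => ?_
  rw [lintegral_indicator_const measurableSet_ball, Measure.addHaar_ball_center]

/-- The comb is the Fourier transform of a function in the range of `beamOp`, with an explicit bound
for its `H^s` norm. -/
theorem exists_beamOp_eq_comb {e : Space n} (he : ‖e‖ = 1) {s : ℝ} (hs : 0 ≤ s) {R : ℕ}
    (hR : 1 ≤ R) (J : ℕ) {ε : ℝ} (hε : 0 ≤ ε) :
    ∃ g : L2 n, ‖g‖ ^ 2 ≤ (∑ j ∈ Finset.range J,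
        (ε * (1 / (2 * j + 1))) ^ 2 * (4 * (R * (2 * j + 1)) ^ 2) ^ s) *
          volume.real (Metric.ball (0 : Space n) (1 / 2)) ∧
      beamOp e hs g =ᵐ[volume] fun x => (ε : ℂ) * 𝓕⁻ (comb e R J) x := by
  have hV : volume (Metric.ball (0 : Space n) (1 / 2)) ≠ ∞ := measure_ball_lt_top.ne
  set G : Space n → ℂ :=
    fun ξ => (ε : ℂ) * (comb e R J ξ * (((1 + ‖ξ‖ ^ 2) ^ (s / 2) : ℝ) : ℂ)) with hG
  have hle := lintegral_comb_le he hs hR J hε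
  have hmem : MemLp G 2 (volume : Measure (Space n)) := by
    refine ⟨?_, ?_⟩
    · have h1 : Continuous fun ξ : Space n => (((1 + ‖ξ‖ ^ 2) ^ (s / 2) : ℝ) : ℂ) :=
        Complex.continuous_ofReal.comp
          (Continuous.rpow_const (by fun_prop) fun ξ => Or.inl (by positivity))
      exact ((memLp_comb e R J).aestronglyMeasurable.mul h1.aestronglyMeasurable).const_mul _
    · rw [eLpNorm_lt_top_iff_lintegral_rpow_enorm_lt_top (by norm_num) (by norm_num)]
      simp only [ENNReal.toReal_ofNat, ENNReal.rpow_ofNat]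
      exact hle.trans_lt (ENNReal.mul_lt_top ENNReal.ofReal_lt_top hV.lt_top)
  refine ⟨hmem.toLp G, ?_, ?_⟩
  · have h0 : ∫⁻ ξ, ‖G ξ‖ₑ ^ 2 = ‖hmem.toLp G‖ₑ ^ 2 := by
      rw [← lintegral_enorm_sq]
      refine lintegral_congr_ae ?_
      filter_upwards [hmem.coeFn_toLp] with ξ hξ
      rw [hξ]
    have h1 := h0.symm.trans_le hle
    rw [← ofReal_norm, ← ENNReal.ofReal_pow (norm_nonneg _), ← ENNReal.ofReal_toReal hV,
      ← ENNReal.ofReal_mul (Finset.sum_nonneg fun j _ => by positivity)] at h1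
    exact (ENNReal.ofReal_le_ofReal_iff (mul_nonneg (Finset.sum_nonneg fun j _ => by positivity)
      ENNReal.toReal_nonneg)).1 h1
  · have hmem' : MemLp (fun ξ => (ε : ℂ) * comb e R J ξ) 2 (volume : Measure (Space n)) :=
      (memLp_comb e R J).const_mul _
    have heq : mulL (memLp_top_decay hs) (mulL (memLp_top_beam e) (hmem.toLp G))
        = hmem'.toLp _ := by
      refine Lp.ext ?_
      filter_upwards [mulL_ae_eq (memLp_top_decay hs) (mulL (memLp_top_beam e) (hmem.toLp G)),
        mulL_ae_eq (memLp_top_beam e) (hmem.toLp G), hmem.coeFn_toLp, hmem'.coeFn_toLp]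
        with ξ e1 e2 e3 e4
      rw [e1, e2, e3, e4]
      by_cases h : comb e R J ξ = 0
      · simp [hG, h]
      · rw [Set.indicator_of_mem (mem_beam_of_comb_ne_zero hR h), one_mul]
        have h2 : decay s ξ * (((1 + ‖ξ‖ ^ 2) ^ (s / 2) : ℝ) : ℂ) = 1 := by
          rw [decay, ← Complex.ofReal_mul, ← Real.rpow_add (by positivity)]
          simp [neg_div]
        calc decay s ξ * G ξ
            = (decay s ξ * (((1 + ‖ξ‖ ^ 2) ^ (s / 2) : ℝ) : ℂ)) * (ε * comb e R J ξ) := by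
              simp only [hG]; ring
          _ = ε * comb e R J ξ := by rw [h2, one_mul]
    rw [beamOp_apply, heq]
    refine (fourierInv_toLp_ae_eq ((integrable_comb e R J).const_mul _) hmem').trans
      (Eventually.of_forall fun x => ?_)
    simp only [fourierInv_eq_integral_character]
    rw [← integral_const_mul]
    refine integral_congr_ae (Eventually.of_forall fun ξ => ?_)
    ring

/-! ### Necessity -/

theorem character_add_smul_comb {e : Space n} (he : ‖e‖ = 1) (R j : ℕ) (x : Space n) (t : ℝ) :
    character (x + t • e) ((R * (2 * j + 1) : ℝ) • e)
      = Complex.exp ((2 * j + 1 : ℕ) *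
        ((R * (inner ℝ x e + t) : ℝ) * (2 * Real.pi * Complex.I))) := by
  rw [character, inner_smul_left, inner_add_right, inner_smul_right, real_inner_self_eq_norm_sq, he,
    real_inner_comm]
  congr 1
  simp only [RCLike.conj_to_real]
  push_cast
  ring

/-- Within a period `1/R` of any point there are two points of the line in the direction `e` at
which the comb is in phase and in opposite phase, respectively. -/
theorem exists_times_fourierInv_comb {e : Space n} (he : ‖e‖ = 1) {R : ℕ} (hR : 1 ≤ R) (J : ℕ)
    (x : Space n) :
    ∃ t₀ t₁ : ℝ, |t₀| ≤ 1 / R ∧ |t₁| ≤ 1 / R ∧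
      𝓕⁻ (comb e R J) (x + t₀ • e) = ((∑ j ∈ Finset.range J, 1 / (2 * j + 1 : ℝ) : ℝ) : ℂ) *
        𝓕⁻ (bump (0 : Space n)) (x + t₀ • e) ∧
      𝓕⁻ (comb e R J) (x + t₁ • e) = -(((∑ j ∈ Finset.range J, 1 / (2 * j + 1 : ℝ) : ℝ) : ℂ) *
        𝓕⁻ (bump (0 : Space n)) (x + t₁ • e)) := by
  have hR0 : (0 : ℝ) < R := by exact_mod_cast hR
  set y : ℝ := inner ℝ x e with hy
  have hf0 := Int.fract_nonneg (R * y)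
  have hf1 := Int.fract_lt_one (R * y)
  have hfl := Int.self_sub_fract (R * y)
  refine ⟨-Int.fract (R * y) / R, (1 / 2 - Int.fract (R * y)) / R, ?_, ?_, ?_, ?_⟩
  · rw [abs_div, abs_of_pos hR0, abs_neg, abs_of_nonneg hf0]
    gcongr
  · rw [abs_div, abs_of_pos hR0]
    gcongr
    rw [abs_le]
    constructor <;> linarith
  · rw [fourierInv_comb]
    congr 1
    push_cast
    refine Finset.sum_congr rfl fun j _ => ?_
    have h1 : R * (y + -Int.fract (R * y) / R) = (⌊R * y⌋ : ℝ) := by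
      rw [← hfl]; field_simp; ring
    have h2 := Complex.exp_int_mul_two_pi_mul_I (((2 * j + 1 : ℕ) : ℤ) * ⌊R * y⌋)
    rw [character_add_smul_comb he, h1]
    push_cast at h2 ⊢
    rw [← mul_assoc, h2, mul_one]
  · rw [fourierInv_comb, ← neg_mul]
    congr 1
    push_cast
    rw [← Finset.sum_neg_distrib]
    refine Finset.sum_congr rfl fun j _ => ?_
    have h1 : R * (y + (1 / 2 - Int.fract (R * y)) / R) = (⌊R * y⌋ : ℝ) + 1 / 2 := by
      rw [← hfl]; field_simp; ring
    have h2 := Complex.exp_int_mul_two_pi_mul_I (((2 * j + 1 : ℕ) : ℤ) * ⌊R * y⌋ + j)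
    have h3 : ((2 * j + 1 : ℕ) : ℂ) *
        ((((⌊R * y⌋ : ℝ) + 1 / 2 : ℝ) : ℂ) * (2 * Real.pi * Complex.I))
        = (((2 * j + 1 : ℕ) : ℤ) * ⌊R * y⌋ + j : ℤ) * (2 * Real.pi * Complex.I)
          + Real.pi * Complex.I := by
      push_cast; ring
    rw [character_add_smul_comb he, h1, h3, Complex.exp_add, h2, Complex.exp_pi_mul_I]
    ring

/-- Quantitative consequence of almost everywhere convergence with rate `|t|^δ` for all of `H^s`,
tested on the combs. -/
theorem exists_comb_bound (hn : 1 ≤ n) {δ s : ℝ} (hδ₀ : 0 ≤ δ) (hδ₁ : δ < 1) (hs : 0 ≤ s)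
    (H : ∀ f : L2 n, MemH s f → ConvergesWithRate δ f) :
    ∃ V > 0, ∃ ρ > 0, ∃ A : ℝ, ∃ R₀ : ℕ, ∀ R ≥ R₀, 1 ≤ R ∧ ∀ (J : ℕ) (ε : ℝ), 0 ≤ ε →
      (∑ j ∈ Finset.range J,
        (ε * (1 / (2 * j + 1))) ^ 2 * (4 * (R * (2 * j + 1) : ℝ) ^ 2) ^ s) * V < ρ ^ 2 →
      ε * V * ∑ j ∈ Finset.range J, 1 / (2 * j + 1 : ℝ) ≤ A * (1 / R) ^ δ := by
  set e : Space n := EuclideanSpace.single ⟨0, hn⟩ 1 with he'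
  have he : ‖e‖ = 1 := by simp [he']
  have hT : ∀ g : L2 n, ∀ᵐ x, ∃ N : ℕ, x ∈ slowSet (beamOp e hs g) e δ (1 / (N + 1)) N := fun g =>
    (H _ (memH_beamOp e hs g)).ae_exists_mem_slowSet hδ₁
      fun t => ae_norm_propagator_sub_le he (integrable_beamOp he hs g) t
  obtain ⟨ρ, hρ, N, hN⟩ := exists_uniform_slowSet (beamOp e hs) hT
    (B := Metric.ball 0 (1 / 8)) measurableSet_ball
    (Metric.measure_ball_pos _ _ (by norm_num)).ne' measure_ball_lt_top.ne
  have hVpos : 0 < volume.real (Metric.ball (0 : Space n) (1 / 2)) :=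
    ENNReal.toReal_pos (Metric.measure_ball_pos _ _ (by norm_num)).ne' measure_ball_lt_top.ne
  refine ⟨_, hVpos, ρ, hρ, 4 * N, N + 9, fun R hR => ⟨by omega, fun J ε hε hlt => ?_⟩⟩
  have hR1 : 1 ≤ R := by omega
  have hR' : (N : ℝ) + 9 ≤ R := by exact_mod_cast hR
  have hN0 : (0 : ℝ) ≤ N := N.cast_nonneg
  obtain ⟨g, hg, hTg⟩ := exists_beamOp_eq_comb he hs hR1 J hε
  have hgρ : ‖g‖ < ρ := lt_of_pow_lt_pow_left₀ 2 hρ.le (hg.trans_lt hlt)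
  obtain ⟨x, hxB, ⟨hx, hxt⟩, hslow⟩ := hN g hgρ _ (hTg.and (ae_ae_line hTg e))
  set F : Space n → ℂ := fun x => (ε : ℂ) * 𝓕⁻ (comb e R J) x with hF
  have hFc : Continuous F := continuous_const.mul (continuous_fourierInv (integrable_comb e R J))
  -- by continuity of `F` the bound at almost every time is a bound at every time
  have hall : ∀ t : ℝ, |t| < 1 / (N + 1) → ‖F (x + t • e) - F x‖ ≤ 2 * N * |t| ^ δ := by
    intro t ht
    by_contra! hcon
    have hopen : IsOpen {t : ℝ | |t| < 1 / (N + 1) ∧ 2 * N * |t| ^ δ < ‖F (x + t • e) - F x‖} := by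
      have h1 : Continuous fun t : ℝ => 2 * N * |t| ^ δ :=
        continuous_const.mul (continuous_abs.rpow_const fun _ => Or.inr hδ₀)
      have h2 : Continuous fun t : ℝ => ‖F (x + t • e) - F x‖ :=
        ((hFc.comp (by fun_prop)).sub continuous_const).norm
      exact (isOpen_lt continuous_abs continuous_const).inter (isOpen_lt h1 h2)
    refine (hopen.measure_pos volume ⟨t, ht, hcon⟩).ne' ?_
    have hae : ∀ᵐ t : ℝ, |t| < 1 / (N + 1) → ‖F (x + t • e) - F x‖ ≤ 2 * N * |t| ^ δ := by
      filter_upwards [hslow, hxt] with t h1 h2 h3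
      rw [← hx, ← h2]
      exact h1 h3
    refine measure_mono_null (fun t ht' => ?_) (ae_iff.1 hae)
    simpa using ht'
  obtain ⟨t₀, t₁, h0, h1, e0, e1⟩ := exists_times_fourierInv_comb he hR1 J x
  set S : ℝ := ∑ j ∈ Finset.range J, 1 / (2 * j + 1 : ℝ) with hS
  have hS0 : 0 ≤ S := Finset.sum_nonneg fun j _ => by positivity
  have hRpos : (0 : ℝ) < R := by linarith
  have hlt' : (1 : ℝ) / R < 1 / (N + 1) := by
    refine one_div_lt_one_div_of_lt (by linarith) (by linarith)
  have hle8 : (1 : ℝ) / R ≤ 1 / 8 := one_div_le_one_div_of_le (by norm_num) (by linarith)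
  have hbd : ∀ t : ℝ, |t| ≤ 1 / R → ‖F (x + t • e) - F x‖ ≤ 2 * N * (1 / R) ^ δ := fun t ht =>
    (hall t (ht.trans_lt hlt')).trans (by gcongr)
  have hφ : ∀ t : ℝ, |t| ≤ 1 / R → volume.real (Metric.ball (0 : Space n) (1 / 2)) / 2
      ≤ (𝓕⁻ (bump (0 : Space n)) (x + t • e)).re := fun t ht => by
    refine re_fourierInv_bump_zero_ge ((norm_add_le _ _).trans ?_)
    rw [norm_smul, he, mul_one, Real.norm_eq_abs]
    have := mem_ball_zero_iff.1 hxB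
    linarith
  have hdiff : F (x + t₀ • e) - F (x + t₁ • e) = ((ε * S : ℝ) : ℂ) *
      (𝓕⁻ (bump (0 : Space n)) (x + t₀ • e) + 𝓕⁻ (bump (0 : Space n)) (x + t₁ • e)) := by
    simp only [hF, e0, e1]
    push_cast
    ring
  calc ε * volume.real (Metric.ball (0 : Space n) (1 / 2)) * S
      = (ε * S) * (volume.real (Metric.ball (0 : Space n) (1 / 2)) / 2 +
          volume.real (Metric.ball (0 : Space n) (1 / 2)) / 2) := by ring
    _ ≤ (ε * S) * ((𝓕⁻ (bump (0 : Space n)) (x + t₀ • e)).re +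
          (𝓕⁻ (bump (0 : Space n)) (x + t₁ • e)).re) := by
        gcongr
        · exact hφ t₀ h0
        · exact hφ t₁ h1
    _ = (F (x + t₀ • e) - F (x + t₁ • e)).re := by
        rw [hdiff, Complex.re_ofReal_mul, Complex.add_re]
    _ ≤ ‖(F (x + t₀ • e) - F x) - (F (x + t₁ • e) - F x)‖ := by
        rw [sub_sub_sub_cancel_right]
        exact Complex.re_le_norm _
    _ ≤ 2 * N * (1 / R) ^ δ + 2 * N * (1 / R) ^ δ :=
        (norm_sub_le _ _).trans (add_le_add (hbd t₀ h0) (hbd t₁ h1))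
    _ = 4 * N * (1 / R) ^ δ := by ring

/-- Almost everywhere convergence with rate `|t|^δ` requires `s ≥ δ`: a single bump at a large
frequency `R` changes by a fixed fraction of its size `R^{-s}` within time `1/R`. -/
theorem le_of_forall_convergesWithRate (hn : 1 ≤ n) {δ s : ℝ} (hδ₀ : 0 ≤ δ) (hδ₁ : δ < 1)
    (hs : 0 ≤ s) (H : ∀ f : L2 n, MemH s f → ConvergesWithRate δ f) : δ ≤ s := by
  by_contra! hlt
  obtain ⟨V, hV, ρ, hρ, A, R₀, hbound⟩ := exists_comb_bound hn hδ₀ hδ₁ hs H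
  have h4 : (0 : ℝ) < 4 ^ s := by positivity
  set c : ℝ := ρ / (2 * √(V * 4 ^ s)) with hc
  have hcpos : 0 < c := by positivity
  have hc2 : c ^ 2 * 4 ^ s * V < ρ ^ 2 := by
    have : c ^ 2 * 4 ^ s * V = ρ ^ 2 / 4 := by
      rw [hc, div_pow, mul_pow, Real.sq_sqrt (by positivity)]
      field_simp
      norm_num
    rw [this]
    nlinarith [pow_pos hρ 2]
  have hlim : Tendsto (fun R : ℕ => A * (R : ℝ) ^ (-(δ - s))) atTop (𝓝 (A * 0)) :=
    ((tendsto_rpow_neg_atTop (sub_pos.2 hlt)).comp tendsto_natCast_atTop_atTop).const_mul A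
  rw [mul_zero] at hlim
  obtain ⟨R, hRlt, hR⟩ := ((hlim.eventually (gt_mem_nhds (mul_pos hcpos hV))).and
    (eventually_ge_atTop R₀)).exists
  obtain ⟨hR1, hb⟩ := hbound R hR
  have hRpos : (0 : ℝ) < R := by exact_mod_cast hR1
  have hRs : (0 : ℝ) < (R : ℝ) ^ s := by positivity
  have hb1 := hb 1 (c / (R : ℝ) ^ s) (by positivity) (by
    refine lt_of_eq_of_lt ?_ hc2
    have h5 : ((R : ℝ) ^ 2) ^ s = ((R : ℝ) ^ s) ^ 2 := by
      rw [← Real.rpow_natCast, ← Real.rpow_natCast, ← Real.rpow_mul hRpos.le,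
        ← Real.rpow_mul hRpos.le, mul_comm]
    simp only [Finset.sum_range_one, Nat.cast_zero, mul_zero, zero_add, mul_one, div_one]
    rw [Real.mul_rpow (by norm_num) (by positivity), h5]
    field_simp)
  simp only [Finset.sum_range_one, Nat.cast_zero, mul_zero, zero_add, mul_one, div_one] at hb1
  have h6 : A * (R : ℝ) ^ (-(δ - s)) = A * (1 / R) ^ δ * (R : ℝ) ^ s := by
    rw [neg_sub, Real.rpow_sub hRpos, Real.div_rpow zero_le_one hRpos.le, Real.one_rpow]
    ring
  rw [h6] at hRlt
  have h7 : c * V = c / (R : ℝ) ^ s * V * (R : ℝ) ^ s := by field_simp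
  rw [h7] at hRlt
  exact absurd hb1 (not_le.2 (lt_of_mul_lt_mul_right hRlt hRs.le))

theorem tendsto_sum_one_div_odd :
    Tendsto (fun J : ℕ => ∑ j ∈ Finset.range J, 1 / (2 * j + 1 : ℝ)) atTop atTop := by
  refine tendsto_atTop_mono (fun J => ?_)
    (Real.tendsto_sum_range_one_div_nat_succ_atTop.const_mul_atTop (by norm_num : (0 : ℝ) < 1 / 2))
  rw [Finset.mul_sum]
  refine Finset.sum_le_sum fun j _ => ?_
  rw [← mul_div_assoc, mul_one, div_div]
  refine one_div_le_one_div_of_le (by positivity) (by linarith)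

/-- Almost everywhere convergence fails in `H^{1/2}`: the combs of bounded norm with many teeth are
unbounded. -/
theorem not_forall_convergesWithRate_half (hn : 1 ≤ n) :
    ¬ ∀ f : L2 n, MemH (1 / 2) f → ConvergesWithRate 0 f := by
  intro H
  obtain ⟨V, hV, ρ, hρ, A, R, hbound⟩ := exists_comb_bound hn le_rfl one_pos (by norm_num) H
  obtain ⟨hR1, hb⟩ := hbound R le_rfl
  have hRpos : (0 : ℝ) < R := by exact_mod_cast hR1
  obtain ⟨J, hJ0, hJ⟩ := ((tendsto_sum_one_div_odd.eventually_gt_atTop 0).and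
    (tendsto_sum_one_div_odd.eventually_gt_atTop (4 * A ^ 2 * R / (ρ ^ 2 * V)))).exists
  set S : ℝ := ∑ j ∈ Finset.range J, 1 / (2 * j + 1 : ℝ) with hS
  set ε : ℝ := ρ / (2 * √(V * R * S)) with hε
  have hεpos : 0 < ε := by positivity
  have hε2 : ε ^ 2 * (V * R * S) = ρ ^ 2 / 4 := by
    rw [hε, div_pow, mul_pow, Real.sq_sqrt (by positivity)]
    field_simp
    norm_num
  have hb1 := hb J ε hεpos.le (by
    have h1 : ∀ j : ℕ, (ε * (1 / (2 * j + 1))) ^ 2 * (4 * (R * (2 * j + 1) : ℝ) ^ 2) ^ (1 / 2 : ℝ)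
        = 2 * ε ^ 2 * R * (1 / (2 * j + 1 : ℝ)) := by
      intro j
      rw [← Real.sqrt_eq_rpow,
        show 4 * (R * (2 * j + 1) : ℝ) ^ 2 = (2 * (R * (2 * j + 1))) ^ 2 by ring,
        Real.sqrt_sq (by positivity)]
      field_simp
    rw [Finset.sum_congr rfl fun j _ => h1 j, ← Finset.mul_sum, ← hS]
    nlinarith [pow_pos hρ 2])
  rw [← hS, Real.rpow_zero, mul_one] at hb1
  have h2 : (ε * V * S) ^ 2 ≤ A ^ 2 := pow_le_pow_left₀ (by positivity) hb1 2
  have h3 : (ε * V * S) ^ 2 * R = ρ ^ 2 / 4 * (V * S) := by rw [← hε2]; ring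
  rw [div_lt_iff₀ (by positivity)] at hJ
  nlinarith [mul_le_mul_of_nonneg_right h2 hRpos.le]

end HalfWave

theorem theorem1p5 (n : ℕ) (hn : 1 ≤ n) (δ s : ℝ) (hδ₀ : 0 ≤ δ) (hδ₁ : δ < 1) :
    (∀ f : HalfWave.L2 n, HalfWave.MemH s f → HalfWave.ConvergesWithRate δ f) ↔
      1 / 2 < s ∧ δ ≤ s := by
  refine ⟨fun H => ?_, fun h f hf => HalfWave.convergesWithRate_of_half_lt hδ₁ h.1 h.2 hf⟩
  have hs : 1 / 2 < s := by
    by_contra! hs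
    exact HalfWave.not_forall_convergesWithRate_half hn fun f hf => (H f (hf.mono hs)).mono hδ₀
  exact ⟨hs, HalfWave.le_of_forall_convergesWithRate hn hδ₀ hδ₁ (by linarith) H⟩
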